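/- Notation and definitions. For a nonempty finite set $A\subset\mathbb R^d$ let $\delta_A=\frac1{\#A}\sum_{a\in A}\delta_a$. Let $\hat\mu(\xi)=\int e^{-2\pi i\xi\cdot x}\,d\mu(x)$ denote the Fourier transform of a Borel probability measure $\mu$ on $\mathbb R^d$. A pair $(R,B)$ is *admissible* if $R$ is a $d\times d$ integer matrix all of whose (complex) eigenvalues have modulus $>1$, $B\subset\mathbb Z^d$ is finite with $\#B\ge2$, and there is $L\subset\mathbb Z^d$ such that the matrix $\big[\frac1{\sqrt{\#B}}e^{-2\pi i(R^{-1}b)\cdot\ell}\big]_{b\in B,\ell\in L}$ is unitary. The *infinite convolution* of $\{(R_k,B_k)\}_{k\ge1}$ is the Borel probability measure $\mu$ which is the weak limit (if it exists) of $\delta_{R_1^{-1}B_1}*\delta_{(R_2R_1)^{-1}B_2}*\cdots*\delta_{(R_k\cdots R_1)^{-1}B_k}$ as $k\to\infty$. Let $\nu_{>k}$ denote the infinite convolution of the shifted sequence $\{(R_{k+j},B_{k+j})\}_{j\ge1}$. A set $\Phi$ of Borel probability measures on $\mathbb R^d$ is an *equi-positive family* if there are $\epsilon_0,\delta_0>0$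 such that for all $x\in[-\frac12,\frac12)^d$ and $\nu\in\Phi$ there is $k_{x,\nu}\in\mathbb Z^d$, with $k_{x,\nu}=0$ if $x=0$, such that $|\hat\nu(x+y+k_{x,\nu})|\ge\epsilon_0$ for all $|y|<\delta_0$. The infinite convolution $\mu$ of $\{(R_k,B_k)\}$ is an *equi-positive measure* if there is a subsequence $\{\nu_{>n_j}\}_{j\ge1}$ of $\{\nu_{>k}\}_{k\ge1}$ that forms an equi-positive family. For a countable set $\Lambda\subset\mathbb R^d$, $(\mu,\Lambda)$ is a *spectral pair* (and $\Lambda$ is a *spectrum* of $\mu$) if the family $\{e^{-2\pi i\lambda\cdot x}\}_{\lambda\in\Lambda}$ is an orthonormal basis of $L^2(\mu)$. **Theorem.** Let $\{(R_k,B_k)\}_{k=1}^\infty$ and $\{(R_k,B'_k)\}_{k=1}^\infty$ be two sequences of admissible pairs in $\mathbb R^d$ satisfying the uniform contractive condition $\sup_k\|R_k^{-1}\|<1$, where $\|\cdot\|$ is the spectral norm. Suppose that $\{B_k\}$ and $\{B'_k\}$ are equivalent, that is, $$\sum_{k=1}^\infty\Big(\frac{\#(B'_k\setminus B_k)}{\#B'_k}+\frac{\#(B_k\setminus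 B'_k)}{\#B_k}\Big)<\infty,$$ and that $B'_k\equiv B_k\pmod{R_k\mathbb Z^d}$ for every $k\ge1$, i.e. $B_k$ and $B'_k$ have the same image in $\mathbb Z^d/R_k\mathbb Z^d$. If the infinite convolution $\mu$ of $\{(R_k,B_k)\}$ exists and is an equi-positive measure, then (1) the infinite convolution $\mu'$ of $\{(R_k,B'_k)\}$ exists and is an equi-positive measure; (2) there exists $\Lambda\subseteq\mathbb Z^d$ such that both $(\mu,\Lambda)$ and $(\mu',\Lambda)$ are spectral pairs. -/

import Mathlib

open MeasureTheory

namespace InfiniteConv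

noncomputable section

/-! Sequences are indexed by `ℕ` starting at `0`: the value at `k` is the `(k+1)`-st member of the
usual sequence indexed from `1`. -/

/-- The inclusion of `ℤ^d` into `ℝ^d`. -/
def intVec {d : ℕ} (v : Fin d → ℤ) : EuclideanSpace ℝ (Fin d) :=
  WithLp.toLp 2 (fun i => (v i : ℝ))

/-- An integer matrix regarded as a real matrix. -/
def realMat {d : ℕ} (R : Matrix (Fin d) (Fin d) ℤ) : Matrix (Fin d) (Fin d) ℝ :=
  R.map (fun z : ℤ => (z : ℝ))

/-- The vector `R⁻¹ b` of `ℝ^d`, for an integer matrix `R` and an integer vector `b`. -/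
def invVec {d : ℕ} (R : Matrix (Fin d) (Fin d) ℤ) (b : Fin d → ℤ) : EuclideanSpace ℝ (Fin d) :=
  Matrix.toEuclideanCLM (n := Fin d) (𝕜 := ℝ) (realMat R)⁻¹ (intVec b)

/-- The uniform discrete measure `δ_A = (1 / #A) ∑_{a ∈ A} δ_a` on a finite set `A`. -/
def uniformDiscrete {E : Type*} [MeasurableSpace E] (A : Finset E) : Measure E :=
  (A.card : NNReal)⁻¹ • ∑ a ∈ A, Measure.dirac a

instance isFiniteMeasure_uniformDiscrete {E : Type*} [MeasurableSpace E] (A : Finset E) :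
    IsFiniteMeasure (uniformDiscrete A) := by
  unfold uniformDiscrete
  infer_instance

/-- `partialConv A n = δ_{A_1} * ⋯ * δ_{A_n}` (the unit mass at `0` when `n = 0`). -/
def partialConv {E : Type*} [AddCommMonoid E] [MeasurableSpace E] (A : ℕ → Finset E) :
    ℕ → Measure E
  | 0 => Measure.dirac 0
  | n + 1 => (partialConv A n).conv (uniformDiscrete (A n))

instance isFiniteMeasure_partialConv {E : Type*} [AddCommMonoid E] [MeasurableSpace E]
    (A : ℕ → Finset E) (n : ℕ) : IsFiniteMeasure (partialConv A n) := by
  induction n with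
  | zero => unfold partialConv; infer_instance
  | succ n ih => unfold partialConv; infer_instance

/-- `partialConv A n`, bundled as a finite measure. -/
def partialConvFinite {E : Type*} [AddCommMonoid E] [MeasurableSpace E] (A : ℕ → Finset E)
    (n : ℕ) : FiniteMeasure E :=
  ⟨partialConv A n, isFiniteMeasure_partialConv A n⟩

/-- The partial convolutions `δ_{A_1} * ⋯ * δ_{A_n}` converge weakly to the probability measure
`ν`, that is, `ν` is the infinite convolution of the sequence `A`. -/
def IsInfiniteConvolutionOfSets {d : ℕ} (A : ℕ → Finset (EuclideanSpace ℝ (Fin d)))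
    (ν : ProbabilityMeasure (EuclideanSpace ℝ (Fin d))) : Prop :=
  Filter.Tendsto (partialConvFinite A) Filter.atTop (nhds ν.toFiniteMeasure)

/-- The product `R_n R_{n-1} ⋯ R_1`. -/
def matProd {d : ℕ} (R : ℕ → Matrix (Fin d) (Fin d) ℤ) : ℕ → Matrix (Fin d) (Fin d) ℤ
  | 0 => 1
  | n + 1 => R n * matProd R n

open scoped Classical in
/-- The finite sets `(R_k R_{k-1} ⋯ R_1)⁻¹ B_k ⊆ ℝ^d`. -/
def scaledDigits {d : ℕ} (R : ℕ → Matrix (Fin d) (Fin d) ℤ) (B : ℕ → Finset (Fin d → ℤ))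
    (k : ℕ) : Finset (EuclideanSpace ℝ (Fin d)) :=
  (B k).image (invVec (matProd R (k + 1)))

/-- `μ` is the infinite convolution
`δ_{R_1⁻¹ B_1} * δ_{(R_2 R_1)⁻¹ B_2} * δ_{(R_3 R_2 R_1)⁻¹ B_3} * ⋯` of `{(R_k, B_k)}`. -/
def IsInfiniteConvolution {d : ℕ} (R : ℕ → Matrix (Fin d) (Fin d) ℤ)
    (B : ℕ → Finset (Fin d → ℤ)) (μ : ProbabilityMeasure (EuclideanSpace ℝ (Fin d))) : Prop :=
  IsInfiniteConvolutionOfSets (scaledDigits R B) μ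

/-- `ν` is the tail measure
`ν_{>k} = δ_{R_{k+1}⁻¹ B_{k+1}} * δ_{(R_{k+2} R_{k+1})⁻¹ B_{k+2}} * ⋯`. -/
def IsTail {d : ℕ} (R : ℕ → Matrix (Fin d) (Fin d) ℤ) (B : ℕ → Finset (Fin d → ℤ)) (k : ℕ)
    (ν : ProbabilityMeasure (EuclideanSpace ℝ (Fin d))) : Prop :=
  IsInfiniteConvolution (fun j => R (k + j)) (fun j => B (k + j)) ν

/-- The exponential `x ↦ e^{-2πi ξ·x}`. -/
def expFun {d : ℕ} (ξ x : EuclideanSpace ℝ (Fin d)) : ℂ :=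
  Complex.exp (-(2 * (Real.pi : ℂ) * Complex.I * ((inner ℝ ξ x : ℝ) : ℂ)))

/-- The Fourier transform `∫ e^{-2πi ξ·x} dμ(x)` of a measure. -/
def fourierTransform {d : ℕ} (μ : Measure (EuclideanSpace ℝ (Fin d)))
    (ξ : EuclideanSpace ℝ (Fin d)) : ℂ :=
  ∫ x, expFun ξ x ∂μ

/-- Equi-positive families of Borel probability measures on `ℝ^d`. -/
def IsEquiPositiveFamily {d : ℕ} (Φ : Set (ProbabilityMeasure (EuclideanSpace ℝ (Fin d)))) :
    Prop :=
  ∃ ε₀ : ℝ, 0 < ε₀ ∧ ∃ δ₀ : ℝ, 0 < δ₀ ∧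
    ∀ x : EuclideanSpace ℝ (Fin d), (∀ i, -(1 / 2 : ℝ) ≤ x i ∧ x i < 1 / 2) → ∀ μ ∈ Φ,
      ∃ k : Fin d → ℤ, (x = 0 → k = 0) ∧
        ∀ y : EuclideanSpace ℝ (Fin d), ‖y‖ < δ₀ →
          ε₀ ≤ ‖fourierTransform (μ : Measure (EuclideanSpace ℝ (Fin d))) (x + y + intVec k)‖

/-- `μ` is the infinite convolution of `{(R_k, B_k)}`, and it is an equi-positive measure: some
subsequence `ν_{>n_1}, ν_{>n_2}, …` of its tail measures `ν_{>1}, ν_{>2}, …` forms an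
equi-positive family. -/
def IsEquiPositiveMeasure {d : ℕ} (R : ℕ → Matrix (Fin d) (Fin d) ℤ)
    (B : ℕ → Finset (Fin d → ℤ)) (μ : ProbabilityMeasure (EuclideanSpace ℝ (Fin d))) : Prop :=
  IsInfiniteConvolution R B μ ∧
    ∃ (n : ℕ → ℕ) (ν : ℕ → ProbabilityMeasure (EuclideanSpace ℝ (Fin d))),
      StrictMono n ∧ (∀ j, 1 ≤ n j) ∧ (∀ j, IsTail R B (n j) (ν j)) ∧
        IsEquiPositiveFamily (Set.range ν)

/-- All complex eigenvalues of the integer matrix `R` have modulus strictly greater than `1`. -/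
def IsExpansive {d : ℕ} (R : Matrix (Fin d) (Fin d) ℤ) : Prop :=
  ∀ z : ℂ, Module.End.HasEigenvalue (Matrix.toLin' (R.map (fun m : ℤ => (m : ℂ)))) z → 1 < ‖z‖

/-- The matrix `[(1/√#B) e^{-2πi (R⁻¹ b)·ℓ}]_{b ∈ B, ℓ ∈ L}`. -/
def hadamardMatrix {d : ℕ} (R : Matrix (Fin d) (Fin d) ℤ) (B L : Finset (Fin d → ℤ)) :
    Matrix B L ℂ :=
  Matrix.of fun b l =>
    ((1 / Real.sqrt (B.card : ℝ) : ℝ) : ℂ) * expFun (invVec R b.1) (intVec l.1)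

/-- `(R, B, L)` is a Hadamard triple. Unitarity of the matrix, whose rows are indexed by `B` and
whose columns are indexed by `L`, is expressed by both products with its adjoint. -/
def IsHadamardTriple {d : ℕ} (R : Matrix (Fin d) (Fin d) ℤ) (B L : Finset (Fin d → ℤ)) : Prop :=
  IsExpansive R ∧ 2 ≤ B.card ∧
    hadamardMatrix R B L * (hadamardMatrix R B L).conjTranspose = 1 ∧
    (hadamardMatrix R B L).conjTranspose * hadamardMatrix R B L = 1

/-- `(R, B)` is an admissible pair. -/
def IsAdmissiblePair {d : ℕ} (R : Matrix (Fin d) (Fin d) ℤ) (B : Finset (Fin d → ℤ)) : Prop :=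
  ∃ L : Finset (Fin d → ℤ), IsHadamardTriple R B L

/-- The uniform contractive condition `sup_k ‖R_k⁻¹‖ < 1` for the spectral norm. -/
def UniformContractive {d : ℕ} (R : ℕ → Matrix (Fin d) (Fin d) ℤ) : Prop :=
  ∃ c : ℝ, c < 1 ∧
    ∀ k, ‖Matrix.toEuclideanCLM (n := Fin d) (𝕜 := ℝ) (realMat (R k))⁻¹‖ ≤ c

/-- Equivalence of two sequences of finite sets:
`∑_k (#(A'_k \ A_k) / #A'_k + #(A_k \ A'_k) / #A_k) < ∞`. -/
def EquivalentSeq {α : Type*} [DecidableEq α] (A A' : ℕ → Finset α) : Prop :=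
  Summable fun k =>
    ((A' k \ A k).card : ℝ) / ((A' k).card : ℝ) + ((A k \ A' k).card : ℝ) / ((A k).card : ℝ)

/-- `B' ≡ B (mod R ℤ^d)`: the two sets have the same residues modulo `R ℤ^d`. -/
def CongruentMod {d : ℕ} (R : Matrix (Fin d) (Fin d) ℤ) (B' B : Finset (Fin d → ℤ)) : Prop :=
  (∀ b' ∈ B', ∃ b ∈ B, ∃ z : Fin d → ℤ, b' - b = R.mulVec z) ∧
    (∀ b ∈ B, ∃ b' ∈ B', ∃ z : Fin d → ℤ, b' - b = R.mulVec z)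

/-- `(μ, Λ)` is a spectral pair: `Λ` is countable and the family `e^{-2πi λ·x}`, `λ ∈ Λ`, is an
orthonormal basis of the complex Hilbert space `L²(μ)`. -/
def IsSpectralPair {d : ℕ} (μ : ProbabilityMeasure (EuclideanSpace ℝ (Fin d)))
    (Λ : Set (EuclideanSpace ℝ (Fin d))) : Prop :=
  Λ.Countable ∧
    ∃ b : HilbertBasis Λ ℂ (Lp ℂ 2 (μ : Measure (EuclideanSpace ℝ (Fin d)))),
      ∀ l : Λ, (b l : EuclideanSpace ℝ (Fin d) → ℂ) =ᵐ[(μ : Measure (EuclideanSpace ℝ (Fin d)))]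
        expFun (l : EuclideanSpace ℝ (Fin d))

end

end InfiniteConv

namespace InfiniteConv

open Filter Topology

noncomputable section

/-- The transpose of `R⁻¹`, as an operator on `ℝ^d`. -/
def dual {d : ℕ} (R : Matrix (Fin d) (Fin d) ℤ) :
    EuclideanSpace ℝ (Fin d) →L[ℝ] EuclideanSpace ℝ (Fin d) :=
  ContinuousLinearMap.adjoint (Matrix.toEuclideanCLM (n := Fin d) (𝕜 := ℝ) (realMat R)⁻¹)

/-- The Fourier transform of the uniform measure on the digit set `B`. -/
def mask {d : ℕ} (B : Finset (Fin d → ℤ)) (ξ : EuclideanSpace ℝ (Fin d)) : ℂ :=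
  (B.card : ℂ)⁻¹ * ∑ b ∈ B, expFun ξ (intVec b)

/-- The Fourier transform of the `n`-th partial convolution of `{(R_k, B_k)}`. -/
def maskProd {d : ℕ} (R : ℕ → Matrix (Fin d) (Fin d) ℤ) (B : ℕ → Finset (Fin d → ℤ)) (n : ℕ)
    (ξ : EuclideanSpace ℝ (Fin d)) : ℂ :=
  ∏ k ∈ Finset.range n, mask (B k) (dual (matProd R (k + 1)) ξ)

section expFun

variable {d : ℕ}

lemma expFun_comm (ξ x : EuclideanSpace ℝ (Fin d)) : expFun ξ x = expFun x ξ := by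
  simp only [expFun, real_inner_comm]

lemma expFun_add_left (ξ η x : EuclideanSpace ℝ (Fin d)) :
    expFun (ξ + η) x = expFun ξ x * expFun η x := by
  simp only [expFun, inner_add_left, ← Complex.exp_add]
  congr 1
  push_cast
  ring

lemma expFun_add_right (ξ x y : EuclideanSpace ℝ (Fin d)) :
    expFun ξ (x + y) = expFun ξ x * expFun ξ y := by
  simp only [expFun_comm ξ, expFun_add_left]

@[simp] lemma expFun_zero_left (x : EuclideanSpace ℝ (Fin d)) : expFun 0 x = 1 := by
  simp [expFun]

@[simp] lemma expFun_zero_right (x : EuclideanSpace ℝ (Fin d)) : expFun x 0 = 1 := by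
  simp [expFun]

lemma conj_expFun (ξ x : EuclideanSpace ℝ (Fin d)) :
    (starRingEnd ℂ) (expFun ξ x) = expFun (-ξ) x := by
  simp only [expFun, ← Complex.exp_conj, inner_neg_left]
  congr 1
  simp [Complex.conj_ofNat]

lemma norm_expFun (ξ x : EuclideanSpace ℝ (Fin d)) : ‖expFun ξ x‖ = 1 := by
  have : -(2 * (Real.pi : ℂ) * Complex.I * ((inner ℝ ξ x : ℝ) : ℂ)) =
      ((-(2 * Real.pi * inner ℝ ξ x) : ℝ) : ℂ) * Complex.I := by
    push_cast; ring
  rw [expFun, this, Complex.norm_exp_ofReal_mul_I]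

lemma continuous_expFun (ξ : EuclideanSpace ℝ (Fin d)) : Continuous (expFun ξ) := by
  unfold expFun
  fun_prop

lemma intVec_add (u v : Fin d → ℤ) : intVec (u + v) = intVec u + intVec v := by
  ext i; simp [intVec]

@[simp] lemma intVec_zero : intVec (0 : Fin d → ℤ) = 0 := by
  ext i; simp [intVec]

lemma intVec_sub (u v : Fin d → ℤ) : intVec (u - v) = intVec u - intVec v := by
  ext i; simp [intVec]

lemma intVec_injective : Function.Injective (intVec (d := d)) := by
  intro u v h
  ext i
  have := congrArg (fun x : EuclideanSpace ℝ (Fin d) => x i) h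
  simpa [intVec] using this

lemma expFun_intVec_intVec (u v : Fin d → ℤ) : expFun (intVec u) (intVec v) = 1 := by
  have h : inner ℝ (intVec u) (intVec v) = ((∑ i, v i * u i : ℤ) : ℝ) := by
    simp [intVec, PiLp.inner_apply]
  rw [expFun, h, Complex.exp_eq_one_iff]
  refine ⟨-(∑ i, v i * u i), ?_⟩
  push_cast
  ring

end expFun

section fourier

variable {d : ℕ}

lemma fourierTransform_eq_charFun (μ : Measure (EuclideanSpace ℝ (Fin d)))
    (ξ : EuclideanSpace ℝ (Fin d)) :
    fourierTransform μ ξ = charFun μ (-(2 * Real.pi) • ξ) := by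
  rw [fourierTransform, charFun_apply]
  congr 1 with x
  rw [expFun]
  congr 1
  rw [inner_smul_right, real_inner_comm]
  push_cast
  ring

lemma charFun_eq_fourierTransform (μ : Measure (EuclideanSpace ℝ (Fin d)))
    (t : EuclideanSpace ℝ (Fin d)) :
    charFun μ t = fourierTransform μ ((-(2 * Real.pi))⁻¹ • t) := by
  rw [fourierTransform_eq_charFun, smul_smul, mul_inv_cancel₀, one_smul]
  simp [Real.pi_ne_zero]

lemma continuous_fourierTransform (μ : Measure (EuclideanSpace ℝ (Fin d))) [IsFiniteMeasure μ] :
    Continuous (fourierTransform μ) := by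
  have : fourierTransform μ = fun ξ => charFun μ (-(2 * Real.pi) • ξ) :=
    funext (fourierTransform_eq_charFun μ)
  rw [this]
  fun_prop

lemma fourierTransform_conv (μ ν : Measure (EuclideanSpace ℝ (Fin d))) [IsFiniteMeasure μ]
    [IsFiniteMeasure ν] (ξ : EuclideanSpace ℝ (Fin d)) :
    fourierTransform (μ.conv ν) ξ = fourierTransform μ ξ * fourierTransform ν ξ := by
  simp only [fourierTransform_eq_charFun, charFun_conv]

lemma fourierTransform_uniformDiscrete (A : Finset (EuclideanSpace ℝ (Fin d)))
    (ξ : EuclideanSpace ℝ (Fin d)) :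
    fourierTransform (uniformDiscrete A) ξ = (A.card : ℂ)⁻¹ * ∑ a ∈ A, expFun ξ a := by
  rw [fourierTransform, uniformDiscrete, integral_smul_nnreal_measure, integral_finsetSum_measure]
  · simp [integral_dirac, NNReal.smul_def]
  · intro a _
    exact integrable_dirac (by simp)

lemma isProbabilityMeasure_uniformDiscrete {E : Type*} [MeasurableSpace E] {A : Finset E}
    (hA : A.Nonempty) : IsProbabilityMeasure (uniformDiscrete A) := by
  constructor
  have h : (A.card : ENNReal) ≠ 0 := by simpa using hA.ne_empty
  have h' : (A.card : NNReal) ≠ 0 := by simpa using hA.ne_empty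
  simp only [uniformDiscrete, Measure.smul_apply, Measure.finsetSum_apply, measure_univ,
    Finset.sum_const, nsmul_eq_mul, mul_one, ENNReal.smul_def, smul_eq_mul]
  rw [ENNReal.coe_inv h', ENNReal.coe_natCast, ENNReal.inv_mul_cancel h (by simp)]

lemma isProbabilityMeasure_partialConv {E : Type*} [AddCommMonoid E] [MeasurableSpace E]
    [MeasurableAdd₂ E] {A : ℕ → Finset E} (hA : ∀ k, (A k).Nonempty) (n : ℕ) :
    IsProbabilityMeasure (partialConv A n) := by
  induction n with
  | zero => unfold partialConv; infer_instance
  | succ n ih =>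
    have := isProbabilityMeasure_uniformDiscrete (hA n)
    unfold partialConv
    infer_instance

end fourier

section dual

variable {d : ℕ}

lemma realMat_mul (R S : Matrix (Fin d) (Fin d) ℤ) : realMat (R * S) = realMat R * realMat S :=
  Matrix.map_mul (f := Int.castRingHom ℝ)

lemma det_realMat (R : Matrix (Fin d) (Fin d) ℤ) : (realMat R).det = (R.det : ℝ) :=
  ((Int.castRingHom ℝ).map_det R).symm

lemma inner_invVec (R : Matrix (Fin d) (Fin d) ℤ) (b : Fin d → ℤ)
    (ξ : EuclideanSpace ℝ (Fin d)) :
    inner ℝ ξ (invVec R b) = inner ℝ (dual R ξ) (intVec b) := by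
  rw [dual, ContinuousLinearMap.adjoint_inner_left, invVec]

lemma expFun_invVec (R : Matrix (Fin d) (Fin d) ℤ) (b : Fin d → ℤ)
    (ξ : EuclideanSpace ℝ (Fin d)) :
    expFun ξ (invVec R b) = expFun (dual R ξ) (intVec b) := by
  rw [expFun, inner_invVec, expFun]

lemma dual_mul (R S : Matrix (Fin d) (Fin d) ℤ) (ξ : EuclideanSpace ℝ (Fin d)) :
    dual (R * S) ξ = dual R (dual S ξ) := by
  simp only [dual, realMat_mul, Matrix.mul_inv_rev, map_mul]
  exact congrFun (congrArg DFunLike.coe (ContinuousLinearMap.adjoint_comp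
    (Matrix.toEuclideanCLM (n := Fin d) (𝕜 := ℝ) (realMat S)⁻¹)
    (Matrix.toEuclideanCLM (n := Fin d) (𝕜 := ℝ) (realMat R)⁻¹))) ξ

@[simp] lemma dual_one (ξ : EuclideanSpace ℝ (Fin d)) : dual 1 ξ = ξ := by
  have : realMat (1 : Matrix (Fin d) (Fin d) ℤ) = 1 :=
    Matrix.map_one _ Int.cast_zero Int.cast_one
  simp only [dual, this, inv_one, map_one]
  exact congrFun (congrArg DFunLike.coe (ContinuousLinearMap.adjoint_id
    (𝕜 := ℝ) (E := EuclideanSpace ℝ (Fin d)))) ξ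

lemma norm_dual (R : Matrix (Fin d) (Fin d) ℤ) :
    ‖dual R‖ = ‖Matrix.toEuclideanCLM (n := Fin d) (𝕜 := ℝ) (realMat R)⁻¹‖ :=
  LinearIsometryEquiv.norm_map _ _

lemma toEuclideanCLM_intVec (R : Matrix (Fin d) (Fin d) ℤ) (k : Fin d → ℤ) :
    Matrix.toEuclideanCLM (n := Fin d) (𝕜 := ℝ) (realMat R) (intVec k) =
      intVec (R.mulVec k) := by
  ext i
  simp [intVec, realMat, Matrix.mulVec, dotProduct]

lemma invVec_mulVec {R : Matrix (Fin d) (Fin d) ℤ} (hR : R.det ≠ 0) (k : Fin d → ℤ) :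
    invVec R (R.mulVec k) = intVec k := by
  have hu : IsUnit (realMat R).det := by
    rw [det_realMat]; simpa using hR
  rw [invVec, ← toEuclideanCLM_intVec]
  change ((Matrix.toEuclideanCLM (n := Fin d) (𝕜 := ℝ) (realMat R)⁻¹) *
    (Matrix.toEuclideanCLM (n := Fin d) (𝕜 := ℝ) (realMat R))) (intVec k) = _
  rw [← map_mul, Matrix.nonsing_inv_mul _ hu, map_one]
  rfl

lemma invVec_sub (R : Matrix (Fin d) (Fin d) ℤ) (b c : Fin d → ℤ) :
    invVec R (b - c) = invVec R b - invVec R c := by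
  simp only [invVec, intVec_sub, map_sub]

lemma invVec_injective {R : Matrix (Fin d) (Fin d) ℤ} (hR : R.det ≠ 0) :
    Function.Injective (invVec R) := by
  have hu : IsUnit (realMat R).det := by
    rw [det_realMat]; simpa using hR
  intro b c h
  apply intVec_injective
  have h2 := congrArg (Matrix.toEuclideanCLM (n := Fin d) (𝕜 := ℝ) (realMat R)) h
  have key : ∀ b, Matrix.toEuclideanCLM (n := Fin d) (𝕜 := ℝ) (realMat R) (invVec R b) =
      intVec b := by
    intro b
    change ((Matrix.toEuclideanCLM (n := Fin d) (𝕜 := ℝ) (realMat R)) *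
      (Matrix.toEuclideanCLM (n := Fin d) (𝕜 := ℝ) (realMat R)⁻¹)) (intVec b) = _
    rw [← map_mul, Matrix.mul_nonsing_inv _ hu, map_one]
    rfl
  rwa [key, key] at h2

lemma dual_transpose_mulVec {R : Matrix (Fin d) (Fin d) ℤ} (hR : R.det ≠ 0) (k : Fin d → ℤ) :
    dual R (intVec (R.transpose.mulVec k)) = intVec k := by
  have hu : IsUnit (realMat R).det := by
    rw [det_realMat]; simpa using hR
  have h1 : Matrix.toEuclideanCLM (n := Fin d) (𝕜 := ℝ) (realMat R.transpose) =
      ContinuousLinearMap.adjoint (Matrix.toEuclideanCLM (n := Fin d) (𝕜 := ℝ) (realMat R)) := by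
    rw [← ContinuousLinearMap.star_eq_adjoint, ← map_star]
    congr 1
  rw [← toEuclideanCLM_intVec, h1, dual]
  have h2 := ContinuousLinearMap.adjoint_comp
    (Matrix.toEuclideanCLM (n := Fin d) (𝕜 := ℝ) (realMat R))
    (Matrix.toEuclideanCLM (n := Fin d) (𝕜 := ℝ) (realMat R)⁻¹)
  have h3 : (Matrix.toEuclideanCLM (n := Fin d) (𝕜 := ℝ) (realMat R)).comp
      (Matrix.toEuclideanCLM (n := Fin d) (𝕜 := ℝ) (realMat R)⁻¹) =
      ContinuousLinearMap.id ℝ _ := by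
    change (Matrix.toEuclideanCLM (n := Fin d) (𝕜 := ℝ) (realMat R)) *
      (Matrix.toEuclideanCLM (n := Fin d) (𝕜 := ℝ) (realMat R)⁻¹) = _
    rw [← map_mul, Matrix.mul_nonsing_inv _ hu, map_one]
    rfl
  rw [h3, ContinuousLinearMap.adjoint_id] at h2
  exact (congrFun (congrArg DFunLike.coe h2) (intVec k)).symm

lemma det_ne_zero_of_isExpansive {R : Matrix (Fin d) (Fin d) ℤ} (hR : IsExpansive R) :
    R.det ≠ 0 := by
  intro h
  have h0 : (R.map (fun m : ℤ => (m : ℂ))).det = 0 := by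
    have := (Int.castRingHom ℂ).map_det R
    rw [h, map_zero] at this
    exact this.symm
  obtain ⟨v, hv, hv0⟩ := Matrix.exists_mulVec_eq_zero_iff.2 h0
  have := hR 0 (Module.End.hasEigenvalue_of_hasEigenvector (x := v)
    (Module.End.hasEigenvector_iff.2 ⟨by
      rw [Module.End.mem_eigenspace_iff, Matrix.toLin'_apply, hv0, zero_smul], hv⟩))
  simp at this
  linarith

lemma det_matProd_ne_zero {R : ℕ → Matrix (Fin d) (Fin d) ℤ} (hR : ∀ k, (R k).det ≠ 0) (n : ℕ) :
    (matProd R n).det ≠ 0 := by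
  induction n with
  | zero => simp [matProd]
  | succ n ih => rw [matProd, Matrix.det_mul]; exact mul_ne_zero (hR n) ih

lemma matProd_add (R : ℕ → Matrix (Fin d) (Fin d) ℤ) (n k : ℕ) :
    matProd R (n + k) = matProd (fun j => R (n + j)) k * matProd R n := by
  induction k with
  | zero => simp [matProd]
  | succ k ih => rw [← add_assoc, matProd, ih, matProd, Matrix.mul_assoc]

end dual

section maskProd

variable {d : ℕ} {R : ℕ → Matrix (Fin d) (Fin d) ℤ} {B : ℕ → Finset (Fin d → ℤ)}

lemma norm_mask_le (B : Finset (Fin d → ℤ)) (ξ : EuclideanSpace ℝ (Fin d)) :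
    ‖mask B ξ‖ ≤ 1 := by
  rw [mask, norm_mul, norm_inv, Complex.norm_natCast]
  have h : ‖∑ b ∈ B, expFun ξ (intVec b)‖ ≤ B.card := by
    refine (norm_sum_le _ _).trans ?_
    simp [norm_expFun]
  exact (mul_le_mul_of_nonneg_left h (by positivity)).trans inv_mul_le_one

lemma norm_maskProd_le (n : ℕ) (ξ : EuclideanSpace ℝ (Fin d)) : ‖maskProd R B n ξ‖ ≤ 1 := by
  rw [maskProd, norm_prod]
  exact Finset.prod_le_one (fun _ _ => norm_nonneg _) fun _ _ => norm_mask_le _ _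

lemma continuous_mask (B : Finset (Fin d → ℤ)) : Continuous (mask B) := by
  unfold mask
  simp only [fun ξ b => expFun_comm ξ (intVec b)]
  have := fun b : Fin d → ℤ => continuous_expFun (intVec b)
  fun_prop

lemma continuous_maskProd (n : ℕ) : Continuous (maskProd R B n) := by
  unfold maskProd
  refine continuous_finsetProd _ fun k _ => ?_
  exact (continuous_mask _).comp (dual _).continuous

lemma maskProd_succ (n : ℕ) (ξ : EuclideanSpace ℝ (Fin d)) :
    maskProd R B (n + 1) ξ = maskProd R B n ξ * mask (B n) (dual (matProd R (n + 1)) ξ) :=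
  Finset.prod_range_succ _ _

lemma maskProd_add (n m : ℕ) (ξ : EuclideanSpace ℝ (Fin d)) :
    maskProd R B (n + m) ξ = maskProd R B n ξ *
      maskProd (fun j => R (n + j)) (fun j => B (n + j)) m (dual (matProd R n) ξ) := by
  simp only [maskProd, Finset.prod_range_add]
  congr 1
  refine Finset.prod_congr rfl fun k _ => ?_
  rw [← dual_mul, add_assoc, matProd_add]

lemma mask_add_intVec (B : Finset (Fin d → ℤ)) (ξ : EuclideanSpace ℝ (Fin d)) (k : Fin d → ℤ) :
    mask B (ξ + intVec k) = mask B ξ := by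
  simp only [mask, expFun_add_left, expFun_intVec_intVec, mul_one]

lemma maskProd_add_intVec (hR : ∀ k, (R k).det ≠ 0) (n : ℕ) (ξ : EuclideanSpace ℝ (Fin d))
    (k : Fin d → ℤ) :
    maskProd R B n (ξ + intVec ((matProd R n).transpose.mulVec k)) = maskProd R B n ξ := by
  induction n generalizing k with
  | zero => simp [maskProd]
  | succ n ih =>
    rw [maskProd_succ, maskProd_succ, map_add,
      dual_transpose_mulVec (det_matProd_ne_zero hR (n + 1)), mask_add_intVec, matProd,
      Matrix.transpose_mul, ← Matrix.mulVec_mulVec, ih]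

lemma fourierTransform_scaledDigits (hR : ∀ k, (R k).det ≠ 0) (k : ℕ)
    (ξ : EuclideanSpace ℝ (Fin d)) :
    fourierTransform (uniformDiscrete (scaledDigits R B k)) ξ =
      mask (B k) (dual (matProd R (k + 1)) ξ) := by
  have hinj := invVec_injective (det_matProd_ne_zero hR (k + 1))
  rw [fourierTransform_uniformDiscrete, scaledDigits, Finset.card_image_of_injective _ hinj,
    Finset.sum_image hinj.injOn, mask]
  simp only [expFun_invVec]

lemma fourierTransform_partialConv (hR : ∀ k, (R k).det ≠ 0) (n : ℕ)
    (ξ : EuclideanSpace ℝ (Fin d)) :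
    fourierTransform (partialConv (scaledDigits R B) n) ξ = maskProd R B n ξ := by
  induction n with
  | zero =>
    rw [partialConv, fourierTransform, integral_dirac]
    simp [maskProd]
  | succ n ih =>
    rw [partialConv, fourierTransform_conv, ih, fourierTransform_scaledDigits hR, maskProd_succ]

lemma scaledDigits_nonempty (hB : ∀ k, (B k).Nonempty) (k : ℕ) : (scaledDigits R B k).Nonempty :=
  (hB k).image _

lemma isInfiniteConvolution_iff (hR : ∀ k, (R k).det ≠ 0) (hB : ∀ k, (B k).Nonempty)
    (μ : ProbabilityMeasure (EuclideanSpace ℝ (Fin d))) :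
    IsInfiniteConvolution R B μ ↔ ∀ ξ, Tendsto (fun n => maskProd R B n ξ) atTop
      (𝓝 (fourierTransform (μ : Measure (EuclideanSpace ℝ (Fin d))) ξ)) := by
  let p : ℕ → ProbabilityMeasure (EuclideanSpace ℝ (Fin d)) := fun n =>
    ⟨partialConv (scaledDigits R B) n,
      isProbabilityMeasure_partialConv (scaledDigits_nonempty hB) n⟩
  have h1 : IsInfiniteConvolution R B μ ↔ Tendsto p atTop (𝓝 μ) := by
    rw [ProbabilityMeasure.tendsto_nhds_iff_toFiniteMeasure_tendsto_nhds]
    exact Iff.rfl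
  have h2 : ∀ n ξ, fourierTransform (p n : Measure (EuclideanSpace ℝ (Fin d))) ξ =
      maskProd R B n ξ := fun n ξ => fourierTransform_partialConv hR n ξ
  rw [h1, ProbabilityMeasure.tendsto_iff_tendsto_charFun]
  simp only [charFun_eq_fourierTransform, h2]
  refine ⟨fun h ξ => ?_, fun h t => h _⟩
  have := h (-(2 * Real.pi) • ξ)
  rwa [smul_smul, inv_mul_cancel₀ (by simp [Real.pi_ne_zero]), one_smul] at this

end maskProd

section hadamard

variable {d : ℕ} {R : Matrix (Fin d) (Fin d) ℤ} {B B' L : Finset (Fin d → ℤ)}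

/-- The rows of `[e^{-2πi (R⁻¹ b)·ℓ}]_{b ∈ B, ℓ ∈ L}` are orthogonal. -/
def RowsOrthogonal (R : Matrix (Fin d) (Fin d) ℤ) (B L : Finset (Fin d → ℤ)) : Prop :=
  ∀ b ∈ B, ∀ c ∈ B, ∑ l ∈ L, expFun (invVec R (b - c)) (intVec l) =
    if b = c then (B.card : ℂ) else 0

lemma IsHadamardTriple.rowsOrthogonal (h : IsHadamardTriple R B L) : RowsOrthogonal R B L := by
  intro b hb c hc
  have hN : (B.card : ℂ) ≠ 0 := by
    have := h.2.1
    exact_mod_cast (by omega : B.card ≠ 0)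
  have h1 := congrFun (congrFun h.2.2.1 ⟨b, hb⟩) ⟨c, hc⟩
  have hs : (((1 / Real.sqrt (B.card : ℝ) : ℝ) : ℂ)) * ((1 / Real.sqrt (B.card : ℝ) : ℝ) : ℂ) =
      (B.card : ℂ)⁻¹ := by
    rw [← Complex.ofReal_mul, div_mul_div_comm, Real.mul_self_sqrt (by positivity)]
    simp
  rw [Matrix.mul_apply, Matrix.one_apply] at h1
  simp only [Matrix.conjTranspose_apply, hadamardMatrix, Matrix.of_apply, Subtype.mk.injEq,
    RCLike.star_def, map_mul, Complex.conj_ofReal, conj_expFun] at h1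
  have h2 : ∀ l : Fin d → ℤ, ((1 / Real.sqrt (B.card : ℝ) : ℝ) : ℂ) *
      expFun (invVec R b) (intVec l) * (((1 / Real.sqrt (B.card : ℝ) : ℝ) : ℂ) *
      expFun (-invVec R c) (intVec l)) =
      (B.card : ℂ)⁻¹ * expFun (invVec R (b - c)) (intVec l) := by
    intro l
    rw [invVec_sub, sub_eq_add_neg, expFun_add_left, ← hs]
    ring
  simp only [h2] at h1
  rw [Finset.sum_coe_sort L (fun l => (B.card : ℂ)⁻¹ * expFun (invVec R (b - c)) (intVec l)),
    ← Finset.mul_sum] at h1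
  rw [← mul_right_inj' (inv_ne_zero hN), h1]
  split_ifs <;> simp [hN]

lemma RowsOrthogonal.eq_of_sub_eq_mulVec (hR : R.det ≠ 0) (h : RowsOrthogonal R B L)
    {b c z : Fin d → ℤ} (hb : b ∈ B) (hc : c ∈ B) (hz : b - c = R.mulVec z) : b = c := by
  have hN : (B.card : ℂ) ≠ 0 := by
    exact_mod_cast (Finset.card_pos.2 ⟨b, hb⟩).ne'
  have h1 := h b hb c hc
  have h2 := h b hb b hb
  have h3 : ∀ l : Fin d → ℤ, expFun (invVec R (b - b)) (intVec l) =
      expFun (invVec R (b - c)) (intVec l) := by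
    intro l
    rw [hz, invVec_mulVec hR, expFun_intVec_intVec, sub_self]
    simp [invVec]
  by_contra hbc
  rw [if_neg hbc] at h1
  simp only [h3, h1, if_true] at h2
  exact hN h2.symm

lemma RowsOrthogonal.card_le (hR : R.det ≠ 0) (h : RowsOrthogonal R B L)
    (hc : ∀ b ∈ B, ∃ b' ∈ B', ∃ z : Fin d → ℤ, b' - b = R.mulVec z) : B.card ≤ B'.card := by
  choose! f hf z hz using hc
  refine Finset.card_le_card_of_injOn f hf fun b hb c hc hbc => ?_
  refine h.eq_of_sub_eq_mulVec hR hb hc (z := z c - z b) ?_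
  rw [Matrix.mulVec_sub, ← hz b hb, ← hz c hc, hbc]
  abel

lemma card_eq_of_congruentMod {L' : Finset (Fin d → ℤ)} (hR : R.det ≠ 0)
    (h : RowsOrthogonal R B L) (h' : RowsOrthogonal R B' L') (hmod : CongruentMod R B' B) :
    B'.card = B.card := by
  refine le_antisymm (h'.card_le hR fun b' hb' => ?_) (h.card_le hR hmod.2)
  obtain ⟨b, hb, z, hz⟩ := hmod.1 b' hb'
  exact ⟨b, hb, -z, by rw [Matrix.mulVec_neg, ← hz]; abel⟩

lemma RowsOrthogonal.congr {L' : Finset (Fin d → ℤ)} (hR : R.det ≠ 0)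
    (h : RowsOrthogonal R B L) (h' : RowsOrthogonal R B' L') (hmod : CongruentMod R B' B) :
    RowsOrthogonal R B' L := by
  intro b' hb' c' hc'
  obtain ⟨b, hb, z, hz⟩ := hmod.1 b' hb'
  obtain ⟨c, hc, w, hw⟩ := hmod.1 c' hc'
  have h1 : b' - c' = (b - c) + R.mulVec (z - w) := by
    rw [Matrix.mulVec_sub, ← hz, ← hw]; abel
  have h2 : ∀ l : Fin d → ℤ, expFun (invVec R (b' - c')) (intVec l) =
      expFun (invVec R (b - c)) (intVec l) := by
    intro l
    have : invVec R (b' - c') = invVec R (b - c) + invVec R (R.mulVec (z - w)) := by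
      rw [h1]; simp only [invVec, intVec_add, map_add]
    rw [this, invVec_mulVec hR, expFun_add_left, expFun_intVec_intVec, mul_one]
  simp only [h2, h b hb c hc, card_eq_of_congruentMod hR h h' hmod]
  congr 1
  refine propext ⟨fun hbc => ?_, fun hbc => ?_⟩
  · refine h'.eq_of_sub_eq_mulVec hR hb' hc' (z := z - w) ?_
    rw [h1, hbc, sub_self, zero_add]
  · refine h.eq_of_sub_eq_mulVec hR hb hc (z := w - z) ?_
    rw [hbc, sub_self] at h1
    rw [Matrix.mulVec_sub] at h1 ⊢
    rw [← sub_eq_zero, h1]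
    abel

lemma RowsOrthogonal.image_sub (h : RowsOrthogonal R B L) (l₀ : Fin d → ℤ) :
    RowsOrthogonal R B (L.image fun l => l - l₀) := by
  intro b hb c hc
  rw [Finset.sum_image (sub_left_injective.injOn)]
  simp only [sub_eq_add_neg _ l₀, intVec_add, expFun_add_right, ← Finset.sum_mul, h b hb c hc]
  split_ifs with hbc
  · subst hbc
    simp [invVec]
  · simp

lemma RowsOrthogonal.sum_norm_mask_sq (hB : B.Nonempty) (h : RowsOrthogonal R B L)
    (η : EuclideanSpace ℝ (Fin d)) :
    ∑ l ∈ L, ‖mask B (η + dual R (intVec l))‖ ^ 2 = 1 := by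
  have hN : (B.card : ℂ) ≠ 0 := by
    exact_mod_cast (Finset.card_pos.2 hB).ne'
  have h1 : ∀ l, ((‖mask B (η + dual R (intVec l))‖ ^ 2 : ℝ) : ℂ) =
      (B.card : ℂ)⁻¹ ^ 2 * ∑ b ∈ B, ∑ c ∈ B, expFun η (intVec b) * expFun (-η) (intVec c) *
        expFun (invVec R (b - c)) (intVec l) := by
    intro l
    push_cast
    rw [← Complex.mul_conj', mask]
    simp only [map_mul, map_inv₀, Complex.conj_natCast, map_sum, conj_expFun]
    rw [mul_mul_mul_comm, ← sq, Finset.sum_mul_sum]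
    congr 1
    refine Finset.sum_congr rfl fun b _ => Finset.sum_congr rfl fun c _ => ?_
    rw [neg_add, expFun_add_left, expFun_add_left, ← map_neg, ← expFun_invVec, ← expFun_invVec,
      invVec_sub, sub_eq_add_neg, expFun_add_left]
    have : expFun (-intVec l) (invVec R c) = expFun (-invVec R c) (intVec l) := by
      rw [← conj_expFun, expFun_comm, conj_expFun]
    rw [this, expFun_comm (intVec l)]
    ring
  have h2 : ((∑ l ∈ L, ‖mask B (η + dual R (intVec l))‖ ^ 2 : ℝ) : ℂ) = 1 := by
    rw [Complex.ofReal_sum]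
    simp only [h1]
    rw [← Finset.mul_sum, Finset.sum_comm]
    have h3 : ∀ b ∈ B, ∑ l ∈ L, ∑ c ∈ B, expFun η (intVec b) * expFun (-η) (intVec c) *
        expFun (invVec R (b - c)) (intVec l) = B.card := by
      intro b hb
      rw [Finset.sum_comm]
      simp only [← Finset.mul_sum]
      rw [Finset.sum_congr rfl fun c hc => by rw [h b hb c hc]]
      simp only [mul_ite, mul_zero, Finset.sum_ite_eq, hb, if_true]
      rw [← expFun_add_left]
      simp
    rw [Finset.sum_congr rfl h3]
    simp only [Finset.sum_const, nsmul_eq_mul]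
    field_simp
  exact_mod_cast h2

/-- Congruent digit sets admit a common Hadamard partner containing `0`. -/
lemma exists_common_partner (hB : IsAdmissiblePair R B) (hB' : IsAdmissiblePair R B')
    (hmod : CongruentMod R B' B) :
    ∃ L : Finset (Fin d → ℤ), 0 ∈ L ∧
      (∀ η, ∑ l ∈ L, ‖mask B (η + dual R (intVec l))‖ ^ 2 = 1) ∧
      (∀ η, ∑ l ∈ L, ‖mask B' (η + dual R (intVec l))‖ ^ 2 = 1) := by
  obtain ⟨L, hL⟩ := hB
  obtain ⟨L', hL'⟩ := hB'
  have hR := det_ne_zero_of_isExpansive hL.1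
  have hne : B.Nonempty := Finset.card_pos.1 (by have := hL.2.1; omega)
  have hne' : B'.Nonempty := Finset.card_pos.1 (by have := hL'.2.1; omega)
  obtain ⟨l₀, hl₀⟩ : L.Nonempty := by
    rw [Finset.nonempty_iff_ne_empty]
    rintro rfl
    simpa using hL.rowsOrthogonal.sum_norm_mask_sq hne 0
  refine ⟨L.image fun l => l - l₀, Finset.mem_image.2 ⟨l₀, hl₀, sub_self _⟩, ?_, ?_⟩
  · exact (hL.rowsOrthogonal.image_sub l₀).sum_norm_mask_sq hne
  · exact ((hL.rowsOrthogonal.congr hR hL'.rowsOrthogonal hmod).image_sub l₀).sum_norm_mask_sq hne'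

lemma IsAdmissiblePair.det_ne_zero (h : IsAdmissiblePair R B) : R.det ≠ 0 := by
  obtain ⟨L, hL⟩ := h
  exact det_ne_zero_of_isExpansive hL.1

lemma IsAdmissiblePair.nonempty (h : IsAdmissiblePair R B) : B.Nonempty := by
  obtain ⟨L, hL⟩ := h
  exact Finset.card_pos.1 (by have := hL.2.1; omega)

lemma IsAdmissiblePair.card_eq (hB : IsAdmissiblePair R B) (hB' : IsAdmissiblePair R B')
    (hmod : CongruentMod R B' B) : B'.card = B.card := by
  obtain ⟨L, hL⟩ := hB
  obtain ⟨L', hL'⟩ := hB'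
  exact card_eq_of_congruentMod (det_ne_zero_of_isExpansive hL.1) hL.rowsOrthogonal
    hL'.rowsOrthogonal hmod

end hadamard

section existence

variable {d : ℕ}

/-- If the characteristic functions of a sequence of probability measures converge pointwise to a
function continuous at `0`, then that function is a characteristic function. -/
lemma exists_charFun_eq_of_tendsto {μ : ℕ → ProbabilityMeasure (EuclideanSpace ℝ (Fin d))}
    {f : EuclideanSpace ℝ (Fin d) → ℂ} (hf : ContinuousAt f 0)
    (h : ∀ t, Tendsto (fun n => charFun (μ n : Measure (EuclideanSpace ℝ (Fin d))) t) atTop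
      (𝓝 (f t))) :
    ∃ ν : ProbabilityMeasure (EuclideanSpace ℝ (Fin d)),
      ∀ t, charFun (ν : Measure (EuclideanSpace ℝ (Fin d))) t = f t := by
  have htight := isTightMeasureSet_of_tendsto_charFun hf h
  have hcpt : IsCompact (closure (Set.range μ)) :=
    isCompact_closure_of_isTightMeasureSet (by
      refine htight.subset ?_
      rintro _ ⟨_, ⟨n, rfl⟩, rfl⟩
      exact ⟨n, rfl⟩)
  let U : Ultrafilter ℕ := Ultrafilter.of atTop
  have hU : (U : Filter ℕ) ≤ atTop := Ultrafilter.of_le atTop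
  obtain ⟨ν, -, hν⟩ := hcpt.ultrafilter_le_nhds (U.map μ)
    (le_principal_iff.2 (by
      rw [Ultrafilter.coe_map]
      exact mem_map.2 (univ_mem' fun n => subset_closure ⟨n, rfl⟩)))
  have hν' : Tendsto μ (U : Filter ℕ) (𝓝 ν) := hν
  refine ⟨ν, fun t => tendsto_nhds_unique ?_ ((h t).mono_left hU)⟩
  rw [ProbabilityMeasure.tendsto_iff_forall_integral_rclike_tendsto ℂ] at hν'
  simp_rw [charFun_eq_integral_innerProbChar]
  exact hν' (BoundedContinuousFunction.innerProbChar t)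

lemma norm_mask_sub_mask_le {B B' : Finset (Fin d → ℤ)} (hcard : B'.card = B.card)
    (ξ : EuclideanSpace ℝ (Fin d)) :
    ‖mask B ξ - mask B' ξ‖ ≤
      ((B' \ B).card : ℝ) / (B'.card : ℝ) + ((B \ B').card : ℝ) / (B.card : ℝ) := by
  have hle : ∀ A : Finset (Fin d → ℤ), ‖∑ b ∈ A, expFun ξ (intVec b)‖ ≤ A.card := fun A =>
    (norm_sum_le _ _).trans (by simp [norm_expFun])
  have h : mask B ξ - mask B' ξ = (B.card : ℂ)⁻¹ * (∑ b ∈ B \ B', expFun ξ (intVec b) -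
      ∑ b ∈ B' \ B, expFun ξ (intVec b)) := by
    rw [mask, mask, hcard, ← mul_sub]
    congr 1
    rw [← Finset.sum_inter_add_sum_sdiff B B', ← Finset.sum_inter_add_sum_sdiff B' B,
      Finset.inter_comm B' B]
    ring
  rw [h, hcard, norm_mul, norm_inv, Complex.norm_natCast, ← add_div, div_eq_inv_mul]
  refine mul_le_mul_of_nonneg_left ?_ (by positivity)
  refine (norm_sub_le _ _).trans ?_
  rw [add_comm]
  exact add_le_add (hle _) (hle _)

lemma norm_prod_sub_prod_le {a b : ℕ → ℂ} {ε : ℕ → ℝ} (ha : ∀ k, ‖a k‖ ≤ 1) (hb : ∀ k, ‖b k‖ ≤ 1)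
    (hab : ∀ k, ‖a k - b k‖ ≤ ε k) (n : ℕ) :
    ‖∏ k ∈ Finset.range n, a k - ∏ k ∈ Finset.range n, b k‖ ≤ ∑ k ∈ Finset.range n, ε k := by
  induction n with
  | zero => simp
  | succ n ih =>
    rw [Finset.prod_range_succ, Finset.prod_range_succ, Finset.sum_range_succ]
    have h1 : ‖∏ k ∈ Finset.range n, b k‖ ≤ 1 := by
      rw [norm_prod]
      exact Finset.prod_le_one (fun _ _ => norm_nonneg _) fun k _ => hb k
    calc ‖(∏ k ∈ Finset.range n, a k) * a n - (∏ k ∈ Finset.range n, b k) * b n‖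
        = ‖(∏ k ∈ Finset.range n, a k - ∏ k ∈ Finset.range n, b k) * a n +
            (∏ k ∈ Finset.range n, b k) * (a n - b n)‖ := by ring_nf
      _ ≤ ‖∏ k ∈ Finset.range n, a k - ∏ k ∈ Finset.range n, b k‖ * ‖a n‖ +
            ‖∏ k ∈ Finset.range n, b k‖ * ‖a n - b n‖ := by
          refine (norm_add_le _ _).trans ?_
          rw [norm_mul, norm_mul]
      _ ≤ ‖∏ k ∈ Finset.range n, a k - ∏ k ∈ Finset.range n, b k‖ * 1 + 1 * ‖a n - b n‖ := by
          gcongr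
          exact ha n
      _ ≤ _ := by rw [mul_one, one_mul]; exact add_le_add ih (hab n)

variable {R : ℕ → Matrix (Fin d) (Fin d) ℤ} {B B' : ℕ → Finset (Fin d → ℤ)} {ε : ℕ → ℝ}

lemma norm_maskProd_sub_le (hε : Summable ε) (hε0 : ∀ k, 0 ≤ ε k)
    (hBB : ∀ k ξ, ‖mask (B k) ξ - mask (B' k) ξ‖ ≤ ε k) (n : ℕ)
    (ξ : EuclideanSpace ℝ (Fin d)) :
    ‖maskProd R B n ξ - maskProd R B' n ξ‖ ≤ ∑' k, ε k :=
  (norm_prod_sub_prod_le (fun _ => norm_mask_le _ _) (fun _ => norm_mask_le _ _)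
    (fun k => hBB k _) n).trans (hε.sum_le_tsum _ fun k _ => hε0 k)

lemma norm_fourierTransform_sub_le (hR : ∀ k, (R k).det ≠ 0) (hB : ∀ k, (B k).Nonempty)
    (hB' : ∀ k, (B' k).Nonempty) (hε : Summable ε) (hε0 : ∀ k, 0 ≤ ε k)
    (hBB : ∀ k ξ, ‖mask (B k) ξ - mask (B' k) ξ‖ ≤ ε k)
    {μ μ' : ProbabilityMeasure (EuclideanSpace ℝ (Fin d))} (hμ : IsInfiniteConvolution R B μ)
    (hμ' : IsInfiniteConvolution R B' μ') (ξ : EuclideanSpace ℝ (Fin d)) :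
    ‖fourierTransform (μ : Measure (EuclideanSpace ℝ (Fin d))) ξ -
      fourierTransform (μ' : Measure (EuclideanSpace ℝ (Fin d))) ξ‖ ≤ ∑' k, ε k :=
  le_of_tendsto (((isInfiniteConvolution_iff hR hB μ).1 hμ ξ).sub
    ((isInfiniteConvolution_iff hR hB' μ').1 hμ' ξ)).norm
    (Eventually.of_forall fun n => norm_maskProd_sub_le hε hε0 hBB n ξ)

lemma tendsto_tsum_add (ε : ℕ → ℝ) : Tendsto (fun n => ∑' k, ε (n + k)) atTop (𝓝 0) :=
  (tendsto_sum_nat_add ε).congr fun n => tsum_congr fun k => by rw [add_comm]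

/-- If `{B_k}` and `{B'_k}` are close in a summable sense and arbitrarily late tails of
`{(R_k, B_k)}` exist, then the infinite convolution of `{(R_k, B'_k)}` exists. -/
theorem exists_isInfiniteConvolution (hR : ∀ k, (R k).det ≠ 0) (hB : ∀ k, (B k).Nonempty)
    (hB' : ∀ k, (B' k).Nonempty) (hε : Summable ε) (hε0 : ∀ k, 0 ≤ ε k)
    (hBB : ∀ k ξ, ‖mask (B k) ξ - mask (B' k) ξ‖ ≤ ε k)
    (htail : ∀ N, ∃ n, N ≤ n ∧ ∃ ν, IsTail R B n ν) :
    ∃ μ', IsInfiniteConvolution R B' μ' := by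
  have key : ∀ n ν, IsTail R B n ν → ∀ ξ (η : ℝ), 0 < η → ∀ᶠ m in atTop,
      ‖maskProd R B' m ξ - maskProd R B' n ξ * fourierTransform
        (ν : Measure (EuclideanSpace ℝ (Fin d))) (dual (matProd R n) ξ)‖ <
        ∑' k, ε (n + k) + η := by
    intro n ν hν ξ η hη
    have h1 := (isInfiniteConvolution_iff (fun j => hR (n + j)) (fun j => hB (n + j)) ν).1 hν
      (dual (matProd R n) ξ)
    have h2 := (Metric.tendsto_atTop.1 h1) η hη
    obtain ⟨M, hM⟩ := h2
    filter_upwards [eventually_ge_atTop (n + M)] with m hm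
    obtain ⟨m, rfl⟩ := Nat.exists_eq_add_of_le ((Nat.le_add_right n M).trans hm)
    have hm' : M ≤ m := by omega
    rw [maskProd_add, ← mul_sub, norm_mul]
    refine (mul_le_of_le_one_left (norm_nonneg _) (norm_maskProd_le n ξ)).trans_lt ?_
    refine (norm_sub_le_norm_sub_add_norm_sub _
      (maskProd (fun j => R (n + j)) (fun j => B (n + j)) m (dual (matProd R n) ξ)) _).trans_lt ?_
    refine add_lt_add_of_le_of_lt ?_ (by rw [← dist_eq_norm]; exact hM m hm')
    rw [norm_sub_rev]
    exact norm_maskProd_sub_le (ε := fun k => ε (n + k))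
      (hε.comp_injective (add_right_injective n)) (fun k => hε0 _) (fun k => hBB _) m _
  have hτ := tendsto_tsum_add ε
  have hsmall : ∀ η > (0 : ℝ), ∃ n ν, IsTail R B n ν ∧ ∑' k, ε (n + k) < η := by
    intro η hη
    obtain ⟨N, hN⟩ := eventually_atTop.1 (hτ.eventually (gt_mem_nhds hη))
    obtain ⟨n, hn, ν, hν⟩ := htail N
    exact ⟨n, ν, hν, hN n hn⟩
  have hcauchy : ∀ ξ, ∃ z, Tendsto (fun m => maskProd R B' m ξ) atTop (𝓝 z) := by
    intro ξ
    refine cauchySeq_tendsto_of_complete (Metric.cauchySeq_iff'.2 fun η hη => ?_)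
    obtain ⟨n, ν, hν, hn⟩ := hsmall (η / 4) (by positivity)
    obtain ⟨M, hM⟩ := eventually_atTop.1 (key n ν hν ξ (η / 4) (by positivity))
    refine ⟨M, fun m hm => ?_⟩
    rw [dist_eq_norm]
    have h1 := hM m hm
    have h2 := hM M le_rfl
    rw [norm_sub_rev] at h2
    have h3 := norm_sub_le_norm_sub_add_norm_sub (maskProd R B' m ξ)
      (maskProd R B' n ξ * fourierTransform
        (ν : Measure (EuclideanSpace ℝ (Fin d))) (dual (matProd R n) ξ)) (maskProd R B' M ξ)
    linarith
  choose F hF using hcauchy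
  have hFcont : Continuous F := by
    refine continuous_of_uniform_approx_of_continuous fun u hu => ?_
    obtain ⟨η, hη, hηu⟩ := Metric.mem_uniformity_dist.1 hu
    obtain ⟨n, ν, hν, hn⟩ := hsmall (η / 2) (by positivity)
    refine ⟨fun ξ => maskProd R B' n ξ * fourierTransform
      (ν : Measure (EuclideanSpace ℝ (Fin d))) (dual (matProd R n) ξ),
      (continuous_maskProd n).mul ((continuous_fourierTransform _).comp (dual _).continuous),
      fun ξ => hηu ?_⟩
    rw [dist_eq_norm]
    have : ‖F ξ - maskProd R B' n ξ * fourierTransform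
      (ν : Measure (EuclideanSpace ℝ (Fin d))) (dual (matProd R n) ξ)‖ ≤
        ∑' k, ε (n + k) + η / 4 :=
      le_of_tendsto ((hF ξ).sub_const _).norm
        ((key n ν hν ξ (η / 4) (by positivity)).mono fun m hm => hm.le)
    linarith
  let p : ℕ → ProbabilityMeasure (EuclideanSpace ℝ (Fin d)) := fun n =>
    ⟨partialConv (scaledDigits R B') n,
      isProbabilityMeasure_partialConv (scaledDigits_nonempty hB') n⟩
  have hp : ∀ n ξ, fourierTransform (p n : Measure (EuclideanSpace ℝ (Fin d))) ξ =
      maskProd R B' n ξ := fun n ξ => fourierTransform_partialConv hR n ξ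
  obtain ⟨μ', hμ'⟩ := exists_charFun_eq_of_tendsto (μ := p)
    (f := fun t => F ((-(2 * Real.pi))⁻¹ • t)) (by fun_prop) (fun t => by
      simp only [charFun_eq_fourierTransform, hp]
      exact hF _)
  refine ⟨μ', (isInfiniteConvolution_iff hR hB' μ').2 fun ξ => ?_⟩
  rw [fourierTransform_eq_charFun, hμ', smul_smul, inv_mul_cancel₀ (by simp [Real.pi_ne_zero]),
    one_smul]
  exact hF ξ

end existence

section finiteSpectrum

variable {d : ℕ} {R : ℕ → Matrix (Fin d) (Fin d) ℤ} {B B' : ℕ → Finset (Fin d → ℤ)} {n : ℕ}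

/-- `Λ` is a spectrum of the `n`-th partial convolution, in terms of the Fourier transform. -/
def IsPartialSpectrum (R : ℕ → Matrix (Fin d) (Fin d) ℤ) (B : ℕ → Finset (Fin d → ℤ)) (n : ℕ)
    (Λ : Finset (Fin d → ℤ)) : Prop :=
  ∀ ξ, ∑ l ∈ Λ, ‖maskProd R B n (ξ + intVec l)‖ ^ 2 = 1

lemma mask_zero {B : Finset (Fin d → ℤ)} (hB : B.Nonempty) : mask B 0 = 1 := by
  have : (B.card : ℂ) ≠ 0 := by exact_mod_cast (Finset.card_pos.2 hB).ne'
  simp [mask, this]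

lemma maskProd_zero_right (hB : ∀ k, (B k).Nonempty) (n : ℕ) : maskProd R B n 0 = 1 := by
  simp [maskProd, mask_zero (hB _)]

lemma IsPartialSpectrum.of_sum (hB : ∀ k, (B k).Nonempty) {ι : Type*} {s : Finset ι}
    {f : ι → Fin d → ℤ} (h : ∀ ξ, ∑ i ∈ s, ‖maskProd R B n (ξ + intVec (f i))‖ ^ 2 = 1) :
    IsPartialSpectrum R B n (s.image f) := by
  classical
  have hinj : Set.InjOn f s := by
    intro i hi j hj hij
    by_contra hne
    have h1 : ∑ a ∈ {i, j}, ‖maskProd R B n (-intVec (f i) + intVec (f a))‖ ^ 2 ≤ 1 := by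
      rw [← h (-intVec (f i))]
      refine Finset.sum_le_sum_of_subset_of_nonneg ?_ fun _ _ _ => by positivity
      intro a ha
      rcases Finset.mem_insert.1 ha with rfl | ha
      · exact hi
      · rwa [Finset.mem_singleton.1 ha]
    rw [Finset.sum_pair hne, ← hij, neg_add_cancel, maskProd_zero_right hB] at h1
    norm_num at h1
  intro ξ
  rw [Finset.sum_image hinj]
  exact h ξ

lemma IsPartialSpectrum.step (hR : ∀ k, (R k).det ≠ 0) (hB : ∀ k, (B k).Nonempty)
    {Λ L : Finset (Fin d → ℤ)} (hΛ : IsPartialSpectrum R B n Λ)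
    (hL : ∀ η, ∑ l ∈ L, ‖mask (B n) (η + dual (R n) (intVec l))‖ ^ 2 = 1) :
    IsPartialSpectrum R B (n + 1) ((Λ ×ˢ L).image
      fun p => p.1 + (matProd R n).transpose.mulVec p.2) := by
  refine IsPartialSpectrum.of_sum hB fun ξ => ?_
  rw [Finset.sum_product, ← hΛ ξ]
  refine Finset.sum_congr rfl fun a _ => ?_
  have h1 : ∀ l, ‖maskProd R B (n + 1)
      (ξ + intVec (a + (matProd R n).transpose.mulVec l))‖ ^ 2 =
      ‖maskProd R B n (ξ + intVec a)‖ ^ 2 *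
        ‖mask (B n) (dual (matProd R (n + 1)) (ξ + intVec a) + dual (R n) (intVec l))‖ ^ 2 := by
    intro l
    rw [intVec_add, ← add_assoc, maskProd_succ, maskProd_add_intVec hR, map_add, matProd,
      dual_mul _ _ (intVec _), dual_transpose_mulVec (det_matProd_ne_zero hR n), norm_mul, mul_pow]
  simp only [h1, ← Finset.mul_sum, hL, mul_one]

lemma IsPartialSpectrum.perturb (hR : ∀ k, (R k).det ≠ 0) (hB : ∀ k, (B k).Nonempty)
    {Λ : Finset (Fin d → ℤ)} (hΛ : IsPartialSpectrum R B n Λ) (k : (Fin d → ℤ) → Fin d → ℤ) :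
    IsPartialSpectrum R B n (Λ.image fun l => l + (matProd R n).transpose.mulVec (k l)) := by
  refine IsPartialSpectrum.of_sum hB fun ξ => ?_
  rw [← hΛ ξ]
  refine Finset.sum_congr rfl fun a _ => ?_
  rw [intVec_add, ← add_assoc, maskProd_add_intVec hR]

lemma isPartialSpectrum_zero : IsPartialSpectrum R B 0 {0} := by
  intro ξ
  simp [maskProd]

/-- A common spectrum of the `n`-th partial convolutions of two congruent sequences extends to one
of all the later partial convolutions. -/
lemma exists_common_extension (hB : ∀ k, IsAdmissiblePair (R k) (B k))
    (hB' : ∀ k, IsAdmissiblePair (R k) (B' k)) (hmod : ∀ k, CongruentMod (R k) (B' k) (B k))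
    {Λ : Finset (Fin d → ℤ)} (h : IsPartialSpectrum R B n Λ) (h' : IsPartialSpectrum R B' n Λ)
    {m : ℕ} (hm : n ≤ m) :
    ∃ Λ₁, Λ ⊆ Λ₁ ∧ IsPartialSpectrum R B m Λ₁ ∧ IsPartialSpectrum R B' m Λ₁ := by
  have hR := fun k => (hB k).det_ne_zero
  induction m, hm using Nat.le_induction with
  | base => exact ⟨Λ, subset_rfl, h, h'⟩
  | succ m _ ih =>
    obtain ⟨Λ₁, hsub, h1, h1'⟩ := ih
    obtain ⟨L, h0, hL, hL'⟩ := exists_common_partner (hB m) (hB' m) (hmod m)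
    refine ⟨_, fun a ha => ?_, h1.step hR (fun k => (hB k).nonempty) hL,
      h1'.step hR (fun k => (hB' k).nonempty) hL'⟩
    exact Finset.mem_image.2 ⟨(a, 0), Finset.mem_product.2 ⟨hsub ha, h0⟩, by simp⟩

lemma tendsto_dual_matProd (hR : UniformContractive R) (ξ : EuclideanSpace ℝ (Fin d)) :
    Tendsto (fun n => dual (matProd R n) ξ) atTop (𝓝 0) := by
  obtain ⟨c, hc1, hc⟩ := hR
  have hc0 : 0 ≤ c := (norm_nonneg _).trans (hc 0)
  have h : ∀ n, ‖dual (matProd R n) ξ‖ ≤ c ^ n * ‖ξ‖ := by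
    intro n
    induction n with
    | zero => simp [matProd]
    | succ n ih =>
      rw [matProd, dual_mul, pow_succ', mul_assoc]
      refine ((dual (R n)).le_opNorm _).trans ?_
      rw [norm_dual]
      exact mul_le_mul (hc n) ih (norm_nonneg _) hc0
  refine squeeze_zero_norm h ?_
  simpa using (tendsto_pow_atTop_nhds_zero_of_lt_one hc0 hc1).mul_const ‖ξ‖

lemma fourierTransform_eq_mul_tail (hR : ∀ k, (R k).det ≠ 0) (hB : ∀ k, (B k).Nonempty)
    {μ ν : ProbabilityMeasure (EuclideanSpace ℝ (Fin d))} (hμ : IsInfiniteConvolution R B μ)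
    (hν : IsTail R B n ν) (ξ : EuclideanSpace ℝ (Fin d)) :
    fourierTransform (μ : Measure (EuclideanSpace ℝ (Fin d))) ξ = maskProd R B n ξ *
      fourierTransform (ν : Measure (EuclideanSpace ℝ (Fin d))) (dual (matProd R n) ξ) := by
  have h1 := (isInfiniteConvolution_iff hR hB μ).1 hμ ξ
  have h2 := (isInfiniteConvolution_iff (fun j => hR (n + j)) (fun j => hB (n + j)) ν).1 hν
    (dual (matProd R n) ξ)
  have h3 := h1.comp (tendsto_add_atTop_nat n)
  refine tendsto_nhds_unique h3 ((h2.const_mul (maskProd R B n ξ)).congr fun m => ?_)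
  rw [Function.comp_apply, add_comm m n, maskProd_add]

/-- Equi-positivity, with the base point ranging over all of `ℝ^d` and with a zero translation
near the origin. -/
lemma IsEquiPositiveFamily.exists_forall {Φ : Set (ProbabilityMeasure (EuclideanSpace ℝ (Fin d)))}
    (hΦ : IsEquiPositiveFamily Φ) :
    ∃ ε > (0 : ℝ), ∃ δ > (0 : ℝ), ∀ ν ∈ Φ, ∀ x : EuclideanSpace ℝ (Fin d), ∃ k : Fin d → ℤ,
      (‖x‖ < δ → k = 0) ∧ ∀ y : EuclideanSpace ℝ (Fin d), ‖y‖ < δ →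
        ε ≤ ‖fourierTransform (ν : Measure (EuclideanSpace ℝ (Fin d))) (y + (x + intVec k))‖ := by
  obtain ⟨ε, hε, δ, hδ, h⟩ := hΦ
  refine ⟨ε, hε, δ / 2, by positivity, fun ν hν x => ?_⟩
  by_cases hx : ‖x‖ < δ / 2
  · obtain ⟨k, hk0, hk⟩ := h 0 (fun i => by simp) ν hν
    refine ⟨0, fun _ => rfl, fun y hy => ?_⟩
    have := hk (y + x) ((norm_add_le _ _).trans_lt (by linarith))
    simpa [hk0 rfl] using this
  · let z : Fin d → ℤ := fun i => -⌊x i + 1 / 2⌋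
    obtain ⟨k, -, hk⟩ := h (x + intVec z) (fun i => by
      have h1 := Int.floor_le (x i + 1 / 2)
      have h2 := Int.lt_floor_add_one (x i + 1 / 2)
      simp only [intVec, z, PiLp.add_apply]
      push_cast
      constructor <;> linarith) ν hν
    refine ⟨z + k, fun hx' => absurd hx' hx, fun y hy => ?_⟩
    have h3 : y + (x + intVec (z + k)) = x + intVec z + y + intVec k := by
      rw [intVec_add]; abel
    rw [h3]
    exact hk y (by linarith)

/-- `Λ` is a spectrum of the `n`-th partial convolution, and on a neighbourhood of each point of
`Λ` the Fourier transform of `μ` is bounded from below by that of the partial convolution. -/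
structure IsControlledSpectrum (R : ℕ → Matrix (Fin d) (Fin d) ℤ)
    (B : ℕ → Finset (Fin d → ℤ)) (μ : ProbabilityMeasure (EuclideanSpace ℝ (Fin d)))
    (ε δ : ℝ) (n : ℕ) (Λ : Finset (Fin d → ℤ)) : Prop where
  isPartialSpectrum : IsPartialSpectrum R B n Λ
  le_norm : ∀ l ∈ Λ, ∀ ξ, ‖dual (matProd R n) ξ‖ < δ →
    ε * ‖maskProd R B n (ξ + intVec l)‖ ≤
      ‖fourierTransform (μ : Measure (EuclideanSpace ℝ (Fin d))) (ξ + intVec l)‖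

lemma IsPartialSpectrum.isControlledSpectrum (hR : ∀ k, (R k).det ≠ 0)
    (hB : ∀ k, (B k).Nonempty) {μ ν : ProbabilityMeasure (EuclideanSpace ℝ (Fin d))}
    (hμ : IsInfiniteConvolution R B μ) (hν : IsTail R B n ν) {ε δ : ℝ}
    {Λ : Finset (Fin d → ℤ)} (h : IsPartialSpectrum R B n Λ) (k : (Fin d → ℤ) → Fin d → ℤ)
    (hk : ∀ l, ∀ y : EuclideanSpace ℝ (Fin d), ‖y‖ < δ →
      ε ≤ ‖fourierTransform (ν : Measure (EuclideanSpace ℝ (Fin d)))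
        (y + (dual (matProd R n) (intVec l) + intVec (k l)))‖) :
    IsControlledSpectrum R B μ ε δ n
      (Λ.image fun l => l + (matProd R n).transpose.mulVec (k l)) := by
  refine ⟨h.perturb hR hB k, fun l hl ξ hξ => ?_⟩
  obtain ⟨a, -, rfl⟩ := Finset.mem_image.1 hl
  rw [fourierTransform_eq_mul_tail hR hB hμ hν, norm_mul, mul_comm ε]
  refine mul_le_mul_of_nonneg_left ?_ (norm_nonneg _)
  rw [map_add, intVec_add, map_add, dual_transpose_mulVec (det_matProd_ne_zero hR n)]
  exact hk a _ hξ

/-- The inductive construction of increasing common spectra. -/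
theorem exists_controlled_sequence (hR : UniformContractive R)
    (hB : ∀ k, IsAdmissiblePair (R k) (B k)) (hB' : ∀ k, IsAdmissiblePair (R k) (B' k))
    (hmod : ∀ k, CongruentMod (R k) (B' k) (B k))
    {μ μ' : ProbabilityMeasure (EuclideanSpace ℝ (Fin d))} (hμ : IsInfiniteConvolution R B μ)
    (hμ' : IsInfiniteConvolution R B' μ') {ε δ : ℝ}
    (htail : ∀ N, ∃ n, N ≤ n ∧ ∃ ν ν', IsTail R B n ν ∧ IsTail R B' n ν' ∧
      ∀ x : EuclideanSpace ℝ (Fin d), ∃ k : Fin d → ℤ, (‖x‖ < δ → k = 0) ∧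
        ∀ y : EuclideanSpace ℝ (Fin d), ‖y‖ < δ →
          ε ≤ ‖fourierTransform (ν : Measure (EuclideanSpace ℝ (Fin d)))
            (y + (x + intVec k))‖ ∧
          ε ≤ ‖fourierTransform (ν' : Measure (EuclideanSpace ℝ (Fin d)))
            (y + (x + intVec k))‖) (hδ : 0 < δ) :
    ∃ (n : ℕ → ℕ) (Λ : ℕ → Finset (Fin d → ℤ)), StrictMono n ∧ Monotone Λ ∧
      (∀ j, IsControlledSpectrum R B μ ε δ (n j) (Λ j)) ∧
      ∀ j, IsControlledSpectrum R B' μ' ε δ (n j) (Λ j) := by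
  have hdet := fun k => (hB k).det_ne_zero
  let S := {p : ℕ × Finset (Fin d → ℤ) //
    IsPartialSpectrum R B p.1 p.2 ∧ IsPartialSpectrum R B' p.1 p.2}
  have hnext : ∀ s : S, ∃ t : S, s.1.1 < t.1.1 ∧ s.1.2 ⊆ t.1.2 ∧
      IsControlledSpectrum R B μ ε δ t.1.1 t.1.2 ∧
      IsControlledSpectrum R B' μ' ε δ t.1.1 t.1.2 := by
    rintro ⟨⟨n, Λ⟩, h, h'⟩
    have hsmall : ∀ᶠ m in atTop, ∀ l ∈ Λ, ‖dual (matProd R m) (intVec l)‖ < δ := by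
      rw [Finset.eventually_all]
      intro l _
      have := (tendsto_dual_matProd hR (intVec l)).norm
      rw [norm_zero] at this
      exact this.eventually (gt_mem_nhds hδ)
    obtain ⟨N, hN⟩ := eventually_atTop.1 hsmall
    obtain ⟨m, hm, ν, ν', hν, hν', hk⟩ := htail (max N (n + 1))
    have hnm : n < m := (le_max_right _ _).trans hm
    obtain ⟨Λ₁, hsub, h1, h1'⟩ := exists_common_extension hB hB' hmod h h' hnm.le
    choose k hk0 hk using fun l : Fin d → ℤ => hk (dual (matProd R m) (intVec l))
    have hc := h1.isControlledSpectrum hdet (fun k => (hB k).nonempty) hμ hν k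
      fun l y hy => (hk l y hy).1
    have hc' := h1'.isControlledSpectrum hdet (fun k => (hB' k).nonempty) hμ' hν' k
      fun l y hy => (hk l y hy).2
    refine ⟨⟨(m, _), hc.isPartialSpectrum, hc'.isPartialSpectrum⟩, hnm, fun l hl => ?_, hc, hc'⟩
    refine Finset.mem_image.2 ⟨l, hsub hl, ?_⟩
    rw [hk0 l (hN m ((le_max_left _ _).trans hm) l hl), Matrix.mulVec_zero, add_zero]
  choose next hlt hsub hc hc' using hnext
  let s : ℕ → S := fun j => next^[j + 1] ⟨(0, {0}), isPartialSpectrum_zero, isPartialSpectrum_zero⟩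
  have hs : ∀ j, s (j + 1) = next (s j) := fun j => Function.iterate_succ_apply' _ _ _
  have hs' : ∀ j, ∃ t, s j = next t := fun j => ⟨_, Function.iterate_succ_apply' _ _ _⟩
  refine ⟨fun j => (s j).1.1, fun j => (s j).1.2, strictMono_nat_of_lt_succ fun j => ?_,
    monotone_nat_of_le_succ fun j => ?_, fun j => ?_, fun j => ?_⟩
  · rw [hs]; exact hlt _
  · rw [hs]; exact hsub _
  · obtain ⟨t, ht⟩ := hs' j
    simp only [ht]; exact hc t
  · obtain ⟨t, ht⟩ := hs' j
    simp only [ht]; exact hc' t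

end finiteSpectrum

section limit

variable {d : ℕ} {R : ℕ → Matrix (Fin d) (Fin d) ℤ} {B : ℕ → Finset (Fin d → ℤ)}

theorem hasSum_norm_fourierTransform_sq (hR : UniformContractive R)
    (hdet : ∀ k, (R k).det ≠ 0) (hB : ∀ k, (B k).Nonempty)
    {μ : ProbabilityMeasure (EuclideanSpace ℝ (Fin d))} (hμ : IsInfiniteConvolution R B μ)
    {ε δ : ℝ} (hε : 0 < ε) (hδ : 0 < δ) {n : ℕ → ℕ} {Λ : ℕ → Finset (Fin d → ℤ)}
    (hn : StrictMono n) (hΛ : Monotone Λ)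
    (h : ∀ j, IsControlledSpectrum R B μ ε δ (n j) (Λ j)) (ξ : EuclideanSpace ℝ (Fin d)) :
    HasSum (fun l : ⋃ j, (Λ j : Set (Fin d → ℤ)) =>
      ‖fourierTransform (μ : Measure (EuclideanSpace ℝ (Fin d))) (ξ + intVec l)‖ ^ 2) 1 := by
  classical
  set F := fourierTransform (μ : Measure (EuclideanSpace ℝ (Fin d))) with hF
  set S : Set (Fin d → ℤ) := ⋃ j, (Λ j : Set (Fin d → ℤ)) with hS
  have hlim : ∀ l, Tendsto (fun j => ‖maskProd R B (n j) (ξ + intVec l)‖ ^ 2) atTop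
      (𝓝 (‖F (ξ + intVec l)‖ ^ 2)) := fun l =>
    ((((isInfiniteConvolution_iff hdet hB μ).1 hμ (ξ + intVec l)).comp
      hn.tendsto_atTop).norm.pow 2)
  have hmem : ∀ l ∈ S, ∀ᶠ j in atTop, l ∈ Λ j := by
    intro l hl
    obtain ⟨i, hi⟩ := Set.mem_iUnion.1 hl
    filter_upwards [eventually_ge_atTop i] with j hj using hΛ hj hi
  let g : (Fin d → ℤ) → ℝ := S.indicator fun l => ‖F (ξ + intVec l)‖ ^ 2
  let f : ℕ → (Fin d → ℤ) → ℝ := fun j =>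
    (Λ j : Set (Fin d → ℤ)).indicator fun l => ‖maskProd R B (n j) (ξ + intVec l)‖ ^ 2
  have hf0 : ∀ j l, 0 ≤ f j l := fun j l => Set.indicator_nonneg (fun _ _ => by positivity) l
  have hg0 : ∀ l, 0 ≤ g l := fun l => Set.indicator_nonneg (fun _ _ => by positivity) l
  have hfsum : ∀ j, HasSum (f j) 1 := by
    intro j
    have h0 : ∀ l ∉ Λ j, f j l = 0 := fun l hl =>
      Set.indicator_of_notMem (by simpa using hl) _
    have : HasSum (f j) (∑ l ∈ Λ j, f j l) := hasSum_sum_of_ne_finset_zero h0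
    rwa [Finset.sum_congr rfl fun l hl => Set.indicator_of_mem (Finset.mem_coe.2 hl) _,
      (h j).isPartialSpectrum ξ] at this
  have hfg : ∀ l, Tendsto (fun j => f j l) atTop (𝓝 (g l)) := by
    intro l
    by_cases hl : l ∈ S
    · rw [show g l = _ from Set.indicator_of_mem hl _]
      refine (hlim l).congr' ?_
      filter_upwards [hmem l hl] with j hj
      exact (Set.indicator_of_mem (Finset.mem_coe.2 hj)
        fun l => ‖maskProd R B (n j) (ξ + intVec l)‖ ^ 2).symm
    · rw [show g l = _ from Set.indicator_of_notMem hl _]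
      refine tendsto_const_nhds.congr fun j => ?_
      exact (Set.indicator_of_notMem (fun hj => hl (Set.mem_iUnion.2 ⟨j, hj⟩)) _).symm
  have hgsum : Summable g := by
    refine summable_of_sum_le hg0 (c := 1) fun s => ?_
    refine le_of_tendsto (tendsto_finsetSum s fun l _ => hfg l) (Eventually.of_forall fun j => ?_)
    exact sum_le_hasSum s (fun l _ => hf0 j l) (hfsum j)
  have hbound : ∀ᶠ j in atTop, ∀ l, ‖f j l‖ ≤ (ε ^ 2)⁻¹ * g l := by
    have h1 := ((tendsto_dual_matProd hR ξ).comp hn.tendsto_atTop).norm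
    rw [norm_zero] at h1
    filter_upwards [h1.eventually (gt_mem_nhds hδ)] with j hj l
    rw [Real.norm_of_nonneg (hf0 j l)]
    by_cases hl : l ∈ Λ j
    · have h2 := (h j).le_norm l hl ξ hj
      have h3 : f j l = ‖maskProd R B (n j) (ξ + intVec l)‖ ^ 2 :=
        Set.indicator_of_mem (Finset.mem_coe.2 hl) _
      have h4 : g l = ‖F (ξ + intVec l)‖ ^ 2 :=
        Set.indicator_of_mem (Set.mem_iUnion.2 ⟨j, hl⟩) _
      rw [h3, h4, ← div_eq_inv_mul, le_div_iff₀ (by positivity), mul_comm, ← mul_pow]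
      exact pow_le_pow_left₀ (by positivity) h2 2
    · rw [show f j l = 0 from Set.indicator_of_notMem (by simpa using hl) _]
      exact mul_nonneg (by positivity) (hg0 l)
  have hT := tendsto_tsum_of_dominated_convergence (hgsum.mul_left _) hfg hbound
  simp only [(hfsum _).tsum_eq] at hT
  have hone : ∑' l, g l = 1 := (tendsto_nhds_unique tendsto_const_nhds hT).symm
  have : HasSum g 1 := hone ▸ hgsum.hasSum
  exact hasSum_subtype_iff_indicator.2 this

end limit

section completeness

variable {d : ℕ}

lemma integrable_expFun_mul {μ : Measure (EuclideanSpace ℝ (Fin d))}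
    {f : EuclideanSpace ℝ (Fin d) → ℂ} (hf : Integrable f μ) (ξ : EuclideanSpace ℝ (Fin d)) :
    Integrable (fun x => expFun ξ x * f x) μ :=
  hf.bdd_mul (c := 1) (continuous_expFun ξ).aestronglyMeasurable
    (Eventually.of_forall fun x => (norm_expFun ξ x).le)

lemma integral_expFun_withDensity {μ : Measure (EuclideanSpace ℝ (Fin d))}
    {g : EuclideanSpace ℝ (Fin d) → ℝ} (hg : AEMeasurable g μ) (ξ : EuclideanSpace ℝ (Fin d)) :
    fourierTransform (μ.withDensity fun x => ENNReal.ofReal (g x)) ξ =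
      ∫ x, expFun ξ x * ((max (g x) 0 : ℝ) : ℂ) ∂μ := by
  rw [fourierTransform, integral_withDensity_eq_integral_toReal_smul₀ hg.ennreal_ofReal
    (Eventually.of_forall fun x => ENNReal.ofReal_lt_top)]
  congr 1 with x
  rw [ENNReal.toReal_ofReal', Complex.real_smul, mul_comm]

lemma ae_eq_zero_of_fourier_eq_zero_real {μ : Measure (EuclideanSpace ℝ (Fin d))}
    [IsFiniteMeasure μ] {g : EuclideanSpace ℝ (Fin d) → ℝ} (hg : Integrable g μ)
    (h : ∀ ξ, ∫ x, expFun ξ x * (g x : ℂ) ∂μ = 0) : g =ᵐ[μ] 0 := by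
  have hfin : ∀ g : EuclideanSpace ℝ (Fin d) → ℝ, Integrable g μ →
      ∫⁻ x, ENNReal.ofReal (g x) ∂μ ≠ ⊤ := fun g hg => hg.lintegral_lt_top.ne
  have h1 := isFiniteMeasure_withDensity (hfin g hg)
  have h2 := isFiniteMeasure_withDensity (hfin _ hg.neg)
  have heq : μ.withDensity (fun x => ENNReal.ofReal (g x)) =
      μ.withDensity (fun x => ENNReal.ofReal ((-g) x)) := by
    refine Measure.ext_of_charFun (funext fun t => ?_)
    rw [charFun_eq_fourierTransform, charFun_eq_fourierTransform,
      integral_expFun_withDensity hg.aemeasurable,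
      integral_expFun_withDensity hg.neg.aemeasurable, ← sub_eq_zero, ← integral_sub]
    · rw [← h ((-(2 * Real.pi))⁻¹ • t)]
      congr 1 with x
      rw [← mul_sub, ← Complex.ofReal_sub, Pi.neg_apply]
      congr 2
      rcases le_total 0 (g x) with h0 | h0
      · rw [max_eq_left h0, max_eq_right (by linarith), sub_zero]
      · rw [max_eq_right h0, max_eq_left (by linarith)]; ring
    · exact integrable_expFun_mul (hg.pos_part.ofReal) _
    · exact integrable_expFun_mul (hg.neg.pos_part.ofReal) _
  rw [withDensity_eq_iff hg.aemeasurable.ennreal_ofReal hg.neg.aemeasurable.ennreal_ofReal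
    (hfin g hg)] at heq
  filter_upwards [heq] with x hx
  have := congrArg ENNReal.toReal hx
  rw [ENNReal.toReal_ofReal', ENNReal.toReal_ofReal', Pi.neg_apply] at this
  rw [Pi.zero_apply]
  rcases le_total 0 (g x) with h0 | h0
  · rwa [max_eq_left h0, max_eq_right (by linarith)] at this
  · rw [max_eq_right h0, max_eq_left (by linarith)] at this
    linarith

lemma ae_eq_zero_of_fourier_eq_zero {μ : Measure (EuclideanSpace ℝ (Fin d))}
    [IsFiniteMeasure μ] {f : EuclideanSpace ℝ (Fin d) → ℂ} (hf : Integrable f μ)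
    (h : ∀ ξ, ∫ x, expFun ξ x * f x ∂μ = 0) : f =ᵐ[μ] 0 := by
  have hconj : ∀ ξ, ∫ x, expFun ξ x * (starRingEnd ℂ) (f x) ∂μ = 0 := by
    intro ξ
    have h1 := congrArg (starRingEnd ℂ) (h (-ξ))
    rw [← integral_conj, map_zero] at h1
    simpa [conj_expFun] using h1
  have hfc : Integrable (fun x => (starRingEnd ℂ) (f x)) μ := by
    simpa using (Complex.conjCLE.toContinuousLinearMap.integrable_comp hf)
  have hre : (fun x => (f x).re) =ᵐ[μ] 0 := by
    refine ae_eq_zero_of_fourier_eq_zero_real hf.re fun ξ => ?_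
    have h1 : ∀ x, expFun ξ x * ((f x).re : ℂ) =
        (1 / 2 : ℂ) * (expFun ξ x * f x + expFun ξ x * (starRingEnd ℂ) (f x)) := by
      intro x
      rw [Complex.re_eq_add_conj]
      ring
    simp only [h1]
    rw [integral_const_mul, integral_add (integrable_expFun_mul hf ξ)
      (integrable_expFun_mul hfc ξ), h, hconj]
    simp
  have him : (fun x => (f x).im) =ᵐ[μ] 0 := by
    refine ae_eq_zero_of_fourier_eq_zero_real hf.im fun ξ => ?_
    have h1 : ∀ x, expFun ξ x * ((f x).im : ℂ) =
        (1 / (2 * Complex.I) : ℂ) *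
          (expFun ξ x * f x - expFun ξ x * (starRingEnd ℂ) (f x)) := by
      intro x
      rw [Complex.im_eq_sub_conj]
      ring
    simp only [h1]
    rw [integral_const_mul, integral_sub (integrable_expFun_mul hf ξ)
      (integrable_expFun_mul hfc ξ), h, hconj]
    simp
  filter_upwards [hre, him] with x h1 h2
  exact Complex.ext h1 h2

/-- A vector orthogonal to an orthonormal family is orthogonal to every vector for which
Parseval's identity holds. -/
lemma inner_eq_zero_of_hasSum_parseval {H ι : Type*} [NormedAddCommGroup H]
    [InnerProductSpace ℂ H] {v : ι → H} (hv : Orthonormal ℂ v) {x f : H}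
    (hx : HasSum (fun i => ‖inner ℂ (v i) x‖ ^ 2) (‖x‖ ^ 2))
    (hf : ∀ i, inner ℂ f (v i) = 0) : inner ℂ f x = 0 := by
  have hbound : ∀ s : Finset ι, ‖inner ℂ f x‖ ^ 2 ≤
      ‖f‖ ^ 2 * (‖x‖ ^ 2 - ∑ i ∈ s, ‖inner ℂ (v i) x‖ ^ 2) := by
    intro s
    set p := ∑ i ∈ s, inner ℂ (v i) x • v i with hp
    have hfp : inner ℂ f p = 0 := by
      rw [hp, inner_sum]
      exact Finset.sum_eq_zero fun i _ => by rw [inner_smul_right, hf, mul_zero]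
    have hpp : inner ℂ p p = ((∑ i ∈ s, ‖inner ℂ (v i) x‖ ^ 2 : ℝ) : ℂ) := by
      rw [hp, hv.inner_sum]
      push_cast
      exact Finset.sum_congr rfl fun i _ => Complex.conj_mul' _
    have hpx : inner ℂ p x = ((∑ i ∈ s, ‖inner ℂ (v i) x‖ ^ 2 : ℝ) : ℂ) := by
      rw [hp, sum_inner]
      push_cast
      refine Finset.sum_congr rfl fun i _ => ?_
      rw [inner_smul_left, Complex.conj_mul']
    have hnorm : ‖x - p‖ ^ 2 = ‖x‖ ^ 2 - ∑ i ∈ s, ‖inner ℂ (v i) x‖ ^ 2 := by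
      have hpn : ‖p‖ ^ 2 = ∑ i ∈ s, ‖inner ℂ (v i) x‖ ^ 2 := by
        rw [← inner_self_eq_norm_sq (𝕜 := ℂ) p, hpp]
        exact Complex.ofReal_re _
      rw [@norm_sub_sq ℂ, hpn, ← inner_re_symm, hpx]
      simp only [RCLike.re_to_complex, Complex.ofReal_re]
      ring
    have h1 : inner ℂ f x = inner ℂ f (x - p) := by rw [inner_sub_right, hfp, sub_zero]
    rw [h1, ← hnorm, ← mul_pow]
    exact pow_le_pow_left₀ (norm_nonneg _) (norm_inner_le_norm _ _) 2
  have hlim : Tendsto (fun s : Finset ι =>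
      ‖f‖ ^ 2 * (‖x‖ ^ 2 - ∑ i ∈ s, ‖inner ℂ (v i) x‖ ^ 2)) atTop (𝓝 0) := by
    have := (tendsto_const_nhds (x := ‖x‖ ^ 2) (f := atTop)).sub
      (show Tendsto (fun s : Finset ι => ∑ i ∈ s, ‖inner ℂ (v i) x‖ ^ 2) atTop _ from hx)
    simpa using this.const_mul (‖f‖ ^ 2)
  have := ge_of_tendsto hlim (Eventually.of_forall hbound)
  simpa using le_antisymm this (by positivity)

variable {μ : ProbabilityMeasure (EuclideanSpace ℝ (Fin d))}

lemma memLp_expFun (μ : Measure (EuclideanSpace ℝ (Fin d))) [IsFiniteMeasure μ]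
    (ξ : EuclideanSpace ℝ (Fin d)) : MemLp (expFun ξ) 2 μ :=
  MemLp.of_bound (continuous_expFun ξ).aestronglyMeasurable 1
    (Eventually.of_forall fun x => (norm_expFun ξ x).le)

lemma inner_toLp_expFun (μ : Measure (EuclideanSpace ℝ (Fin d))) [IsFiniteMeasure μ]
    (ξ η : EuclideanSpace ℝ (Fin d)) :
    inner ℂ ((memLp_expFun μ ξ).toLp (expFun ξ)) ((memLp_expFun μ η).toLp (expFun η)) =
      fourierTransform μ (η - ξ) := by
  rw [L2.inner_def, fourierTransform]
  refine integral_congr_ae ?_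
  filter_upwards [(memLp_expFun μ ξ).coeFn_toLp, (memLp_expFun μ η).coeFn_toLp] with x h1 h2
  rw [h1, h2, RCLike.inner_apply, conj_expFun, sub_eq_add_neg, expFun_add_left]

theorem isSpectralPair_of_hasSum {Λ : Set (EuclideanSpace ℝ (Fin d))} (hΛ : Λ.Countable)
    (h : ∀ ξ, HasSum (fun l : Λ =>
      ‖fourierTransform (μ : Measure (EuclideanSpace ℝ (Fin d))) (ξ + l)‖ ^ 2) 1) :
    IsSpectralPair μ Λ := by
  classical
  refine ⟨hΛ, ?_⟩
  set e : EuclideanSpace ℝ (Fin d) → Lp ℂ 2 (μ : Measure (EuclideanSpace ℝ (Fin d))) := fun ξ =>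
    (memLp_expFun (μ : Measure (EuclideanSpace ℝ (Fin d))) ξ).toLp (expFun ξ) with he
  have hinner : ∀ ξ η, inner ℂ (e ξ) (e η) =
      fourierTransform (μ : Measure (EuclideanSpace ℝ (Fin d))) (η - ξ) :=
    inner_toLp_expFun _
  have hF0 : fourierTransform (μ : Measure (EuclideanSpace ℝ (Fin d))) 0 = 1 := by
    simp [fourierTransform]
  have hnorm : ∀ ξ, ‖e ξ‖ = 1 := by
    intro ξ
    have h2 : ‖e ξ‖ ^ 2 = 1 := by
      rw [← inner_self_eq_norm_sq (𝕜 := ℂ) (e ξ), hinner, sub_self, hF0]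
      exact Complex.one_re
    nlinarith [norm_nonneg (e ξ)]
  have horth : Orthonormal ℂ fun l : Λ => e l := by
    refine ⟨fun l => hnorm l, fun l m hlm => ?_⟩
    have h1 := sum_le_hasSum {l, m} (fun _ _ => by positivity) (h (-(l : EuclideanSpace ℝ (Fin d))))
    rw [Finset.sum_pair hlm, neg_add_cancel, hF0] at h1
    change inner ℂ (e l) (e m) = 0
    rw [hinner, sub_eq_neg_add, ← norm_eq_zero, ← sq_eq_zero_iff]
    refine le_antisymm ?_ (by positivity)
    norm_num at h1 ⊢
    rw [h1]
  have hbot : (Submodule.span ℂ (Set.range fun l : Λ => e l))ᗮ = ⊥ := by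
    rw [Submodule.eq_bot_iff]
    intro f hf
    have hfe : ∀ l : Λ, inner ℂ f (e l) = 0 := fun l =>
      Submodule.inner_left_of_mem_orthogonal (Submodule.subset_span (Set.mem_range_self l)) hf
    have hall : ∀ ξ, inner ℂ (e ξ) f = 0 := by
      intro ξ
      rw [← inner_eq_zero_symm]
      refine inner_eq_zero_of_hasSum_parseval horth ?_ hfe
      rw [hnorm, one_pow]
      have h1 := h (-ξ)
      simp only [neg_add_eq_sub, ← hinner, norm_inner_symm (e ξ)] at h1
      exact h1
    have hfi : Integrable f (μ : Measure (EuclideanSpace ℝ (Fin d))) :=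
      (Lp.memLp f).integrable one_le_two
    refine (Lp.eq_zero_iff_ae_eq_zero).2 (ae_eq_zero_of_fourier_eq_zero hfi fun ξ => ?_)
    have h1 := hall (-ξ)
    rw [L2.inner_def] at h1
    rw [← h1]
    refine integral_congr_ae ?_
    filter_upwards [(memLp_expFun (μ : Measure (EuclideanSpace ℝ (Fin d))) (-ξ)).coeFn_toLp]
      with x hx
    rw [he]
    simp only [RCLike.inner_apply]
    rw [hx, conj_expFun, neg_neg, mul_comm]
  refine ⟨HilbertBasis.mkOfOrthogonalEqBot horth hbot, fun l => ?_⟩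
  rw [HilbertBasis.coe_mkOfOrthogonalEqBot]
  exact (memLp_expFun _ _).coeFn_toLp

end completeness

section main

variable {d : ℕ} {R : ℕ → Matrix (Fin d) (Fin d) ℤ} {B B' : ℕ → Finset (Fin d → ℤ)}

lemma IsTail.shift {n m : ℕ} {ν : ProbabilityMeasure (EuclideanSpace ℝ (Fin d))}
    (h : IsTail R B (n + m) ν) :
    IsTail (fun j => R (n + j)) (fun j => B (n + j)) m ν := by
  simpa only [IsTail, add_assoc] using h

theorem isSpectralPair_of_isControlledSpectrum (hR : UniformContractive R)
    (hB : ∀ k, IsAdmissiblePair (R k) (B k))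
    {μ : ProbabilityMeasure (EuclideanSpace ℝ (Fin d))} (hμ : IsInfiniteConvolution R B μ)
    {ε δ : ℝ} (hε : 0 < ε) (hδ : 0 < δ) {n : ℕ → ℕ} {Λ : ℕ → Finset (Fin d → ℤ)}
    (hn : StrictMono n) (hΛ : Monotone Λ)
    (h : ∀ j, IsControlledSpectrum R B μ ε δ (n j) (Λ j)) :
    IsSpectralPair μ (intVec '' ⋃ j, (Λ j : Set (Fin d → ℤ))) := by
  refine isSpectralPair_of_hasSum ((Set.to_countable _).image _) fun ξ => ?_
  rw [← (Equiv.Set.image intVec (⋃ j, (Λ j : Set (Fin d → ℤ))) intVec_injective).hasSum_iff]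
  exact hasSum_norm_fourierTransform_sq hR (fun k => (hB k).det_ne_zero)
    (fun k => (hB k).nonempty) hμ hε hδ hn hΛ h ξ

end main

end

end InfiniteConv

open Filter Topology in
theorem mainTheorem3 {d : ℕ} (R : ℕ → Matrix (Fin d) (Fin d) ℤ)
    (B B' : ℕ → Finset (Fin d → ℤ))
    (hB : ∀ k, InfiniteConv.IsAdmissiblePair (R k) (B k))
    (hB' : ∀ k, InfiniteConv.IsAdmissiblePair (R k) (B' k))
    (hR : InfiniteConv.UniformContractive R)
    (hequiv : InfiniteConv.EquivalentSeq B B')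
    (hmod : ∀ k, InfiniteConv.CongruentMod (R k) (B' k) (B k))
    (μ : MeasureTheory.ProbabilityMeasure (EuclideanSpace ℝ (Fin d)))
    (hμ : InfiniteConv.IsInfiniteConvolution R B μ)
    (hpos : InfiniteConv.IsEquiPositiveMeasure R B μ) :
    ∃ μ' : MeasureTheory.ProbabilityMeasure (EuclideanSpace ℝ (Fin d)),
      InfiniteConv.IsInfiniteConvolution R B' μ' ∧
      InfiniteConv.IsEquiPositiveMeasure R B' μ' ∧
      ∃ Λ : Set (Fin d → ℤ),
        InfiniteConv.IsSpectralPair μ (InfiniteConv.intVec '' Λ) ∧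
        InfiniteConv.IsSpectralPair μ' (InfiniteConv.intVec '' Λ) := by
  obtain ⟨-, n, ν, hn, hn1, hν, hΦ⟩ := hpos
  obtain ⟨ε, hε, δ, hδ, hk⟩ := hΦ.exists_forall
  have hdet := fun k => (hB k).det_ne_zero
  have hne := fun k => (hB k).nonempty
  have hne' := fun k => (hB' k).nonempty
  set τ : ℕ → ℝ := fun k => ((B' k \ B k).card : ℝ) / ((B' k).card : ℝ) +
    ((B k \ B' k).card : ℝ) / ((B k).card : ℝ) with hτ
  have hτs : Summable τ := hequiv
  have hτ0 : ∀ k, 0 ≤ τ k := fun k => by positivity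
  have hτB : ∀ k ξ, ‖InfiniteConv.mask (B k) ξ - InfiniteConv.mask (B' k) ξ‖ ≤ τ k := fun k ξ =>
    InfiniteConv.norm_mask_sub_mask_le ((hB k).card_eq (hB' k) (hmod k)) ξ
  have hτs' : ∀ m, Summable fun k => τ (m + k) := fun m =>
    hτs.comp_injective (add_right_injective m)
  obtain ⟨μ', hμ'⟩ := InfiniteConv.exists_isInfiniteConvolution hdet hne hne' hτs hτ0 hτB
    fun N => ⟨n N, hn.id_le N, ν N, hν N⟩
  have htail : ∀ j, ∃ ν', InfiniteConv.IsTail R B' (n j) ν' := by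
    intro j
    refine InfiniteConv.exists_isInfiniteConvolution (R := fun k => R (n j + k))
      (B := fun k => B (n j + k)) (B' := fun k => B' (n j + k)) (fun k => hdet _)
      (fun k => hne _) (fun k => hne' _) (hτs' (n j)) (fun k => hτ0 _) (fun k => hτB _)
      fun N => ?_
    obtain ⟨m, hm⟩ := Nat.exists_eq_add_of_le ((Nat.le_add_right (n j) N).trans
      (hn.id_le (n j + N)))
    have hνm := hν (n j + N)
    rw [hm] at hνm
    refine ⟨m, ?_, _, hνm.shift⟩
    have : n j + N ≤ n (n j + N) := hn.id_le _
    omega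
  choose ν' hν' using htail
  obtain ⟨J, hJ⟩ := eventually_atTop.1 (((InfiniteConv.tendsto_tsum_add τ).comp
    hn.tendsto_atTop).eventually (gt_mem_nhds (half_pos hε)))
  have hclose : ∀ j, J ≤ j → ∀ ξ,
      ε ≤ ‖InfiniteConv.fourierTransform
        (ν j : MeasureTheory.Measure (EuclideanSpace ℝ (Fin d))) ξ‖ →
      ε / 2 ≤ ‖InfiniteConv.fourierTransform
        (ν' j : MeasureTheory.Measure (EuclideanSpace ℝ (Fin d))) ξ‖ := by
    intro j hj ξ hξ
    have h1 := InfiniteConv.norm_fourierTransform_sub_le (fun k => hdet (n j + k))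
      (fun k => hne (n j + k)) (fun k => hne' (n j + k)) (hτs' (n j)) (fun k => hτ0 _)
      (fun k => hτB _) (hν j) (hν' j) ξ
    have h2 : ∑' k, τ (n j + k) < ε / 2 := hJ j hj
    have h3 := (norm_sub_norm_le _ _).trans h1
    linarith
  refine ⟨μ', hμ', ⟨hμ', fun j => n (J + j), fun j => ν' (J + j),
    fun a b hab => hn (by omega), fun j => hn1 _, fun j => hν' _, ε / 2, half_pos hε, δ, hδ, ?_⟩,
    ?_⟩
  · rintro x - _ ⟨j, rfl⟩
    obtain ⟨k, hk0, hk1⟩ := hk (ν (J + j)) ⟨_, rfl⟩ x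
    refine ⟨k, fun hx => hk0 (by rwa [hx, norm_zero]), fun y hy => ?_⟩
    rw [add_comm x y, add_assoc]
    exact hclose (J + j) (Nat.le_add_right _ _) _ (hk1 y hy)
  · obtain ⟨m, Λ, hm, hΛ, hc, hc'⟩ := InfiniteConv.exists_controlled_sequence (ε := ε / 2) (δ := δ)
      hR hB hB' hmod hμ hμ' (fun N => by
        refine ⟨n (J + N), (Nat.le_add_left N J).trans (hn.id_le _), ν (J + N), ν' (J + N),
          hν _, hν' _, fun x => ?_⟩
        obtain ⟨k, hk0, hk1⟩ := hk (ν (J + N)) ⟨_, rfl⟩ x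
        exact ⟨k, hk0, fun y hy => ⟨(half_le_self hε.le).trans (hk1 y hy),
          hclose (J + N) (Nat.le_add_right _ _) _ (hk1 y hy)⟩⟩) hδ
    exact ⟨_, InfiniteConv.isSpectralPair_of_isControlledSpectrum hR hB hμ (half_pos hε) hδ hm hΛ
      hc, InfiniteConv.isSpectralPair_of_isControlledSpectrum hR hB' hμ' (half_pos hε) hδ hm hΛ hc'⟩
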